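/- Let $\lambda\in[0,1]$. For a symmetric probability measure $\mu$ on $\mathbb R$ put $$G_\mu(z)=\int\frac{d\mu(t)}{z-t},\qquad H_\mu(z)=\lambda\,G_\mu\!\left(\tfrac1{\sqrt z}\right)^2+(1-\lambda)\sqrt z\,G_\mu\!\left(\tfrac1{\sqrt z}\right),$$ where $\sqrt{\cdot}$ is the analytic square root on $\mathbb C\setminus[0,\infty)$ with $\sqrt{-1}=i$. The *rectangular $R$-transform with ratio $\lambda$* of $\mu$ is $C_\mu(z)=U\big(z/H_\mu^{-1}(z)-1\big)$, defined for small $z$ in every sector $|\arg z-\pi|<\alpha$ with $0<\alpha<\pi$. Here $H_\mu^{-1}$ is the compositional inverse of $H_\mu$ that is analytic near $0$ in each of these sectors with $H_\mu^{-1}(z)/z\to1$ as $z\to 0$ there, and $U(z)=\frac{-\lambda-1+[(\lambda+1)^2+4\lambda z]^{1/2}}{2\lambda}$ (principal root; $U(z)=z$ if $\lambda=0$). The *rectangular free convolution* $\mu\boxplus_\lambda\nu$ is the symmetric probability measure with $C_{\mu\boxplus_\lambda\nu}=C_\mu+C_\nu$. A symmetric law $\nu$ is *$\boxplus_\lambda$-infinitely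 divisible* if for every $n\ge1$ it is the $n$-fold $\boxplus_\lambda$-power of a symmetric law. A symmetric finite positive measure $G$ is the *Lévy measure* of a symmetric classically infinitely divisible law $\mu$ if $\int e^{it\xi}\,d\mu(t)=\exp\int(\cos(t\xi)-1)\frac{1+t^2}{t^2}\,dG(t)$ for all real $\xi$ (the integrand being $-\xi^2/2$ at $t=0$), and of a $\boxplus_\lambda$-infinitely divisible law $\nu$ if $C_\nu(z)=z\int\frac{1+t^2}{1-zt^2}\,dG(t)$. The *rectangular Bercovici–Pata bijection* $\Lambda_\lambda$ maps a symmetric classically infinitely divisible law to the $\boxplus_\lambda$-infinitely divisible law with the same Lévy measure. The *free cumulants with ratio $\lambda$*, $(c_{2n}(\mu))_{n\ge1}$, of a symmetric law $\mu$ with moments of all orders are determined by $$\int x^{2n}\,d\mu(x)=\sum_{\pi}\lambda^{e(\pi)}\prod_{V\in\pi}c_{|V|}(\mu)\qquad(n\ge1),$$ where $\pi$ runs over the noncrossing partitions of $\{1,\dots,2n\}$ with all blocks of even cardinality and $e(\pi)$ is the number of blocks with even minimum. **Theorem.** The image $\nu=\Lambda_\lambda(N(0,1))$ of the standard Gaussian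 law exists and is unique. It has moments of all orders, and its free cumulants with ratio $\lambda$ are $c_{2n}(\nu)=\delta_{n,1}$ for all $n\ge1$. If $\lambda=0$, then $\nu=(\delta_1+\delta_{-1})/2$. If $\lambda>0$, then $\nu$ has density $$x\mapsto\frac{[4\lambda-(x^2-1-\lambda)^2]^{1/2}}{2\pi\lambda|x|}\,\chi(x^2),$$ where $\chi$ is the indicator function of $[(1-\sqrt\lambda)^2,(1+\sqrt\lambda)^2]$; the support of $\nu$ is $[-1-\sqrt\lambda,-1+\sqrt\lambda]\cup[1-\sqrt\lambda,1+\sqrt\lambda]$; and the push-forward of $\nu$ by $x\mapsto x^2$ is the push-forward by $t\mapsto\lambda t$ of the Marchenko–Pastur law with parameter $1/\lambda$. (For $c>0$, the Marchenko–Pastur law with parameter $c$ is $\max(1-c,0)\,\delta_0+\frac{[4c-(x-1-c)^2]^{1/2}}{2\pi x}\mathbf 1_{[(1-\sqrt c)^2,(1+\sqrt c)^2]}(x)\,dx$.) -/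

import Mathlib

open MeasureTheory ProbabilityTheory Filter Topology

namespace RectFree

noncomputable section

/-! ## Symmetric laws and classical infinite divisibility -/

/-- Symmetric probability measures on the real line. -/
structure IsSymmProb (μ : Measure ℝ) : Prop where
  prob : IsProbabilityMeasure μ
  symm : μ.IsNegInvariant

/-- The `n`-fold classical convolution power. -/
def convPow (μ : Measure ℝ) : ℕ → Measure ℝ
  | 0 => Measure.dirac 0
  | n + 1 => (convPow μ n).conv μ

/-- Classical infinite divisibility. -/
def IsInfDiv (μ : Measure ℝ) : Prop :=
  ∀ n : ℕ, 1 ≤ n → ∃ κ : Measure ℝ, IsProbabilityMeasure κ ∧ convPow κ n = μ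

/-- The function `t ↦ (cos (t ξ) - 1) (1 + t²) / t²`, extended by continuity at `t = 0`. -/
def levyKernel (ξ t : ℝ) : ℝ :=
  if t = 0 then -(ξ ^ 2 / 2) else (Real.cos (t * ξ) - 1) * ((1 + t ^ 2) / t ^ 2)

/-- Symmetric finite positive measures on the real line. -/
structure IsSymmFinite (G : Measure ℝ) : Prop where
  finite : IsFiniteMeasure G
  symm : G.IsNegInvariant

/-- `G` is the Lévy measure of the symmetric infinitely divisible law `μ`. -/
def IsLevyMeasure (μ G : Measure ℝ) : Prop :=
  IsSymmFinite G ∧ ∀ ξ : ℝ, charFun μ ξ = Complex.exp ((∫ t, levyKernel ξ t ∂G : ℝ) : ℂ)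

/-! ## The rectangular `R`-transform with ratio `lam` -/

/-- The square root that is analytic off `[0, ∞)` with value `i` at `-1`. -/
def sqrtUpper (z : ℂ) : ℂ := Complex.I * (-z) ^ (1 / 2 : ℂ)

/-- The inverse, near zero, of `X ↦ (lam X + 1) (X + 1) - 1`. -/
def rectU (lam : ℝ) (z : ℂ) : ℂ :=
  if lam = 0 then z
  else (-(lam : ℂ) - 1 + (((lam : ℂ) + 1) ^ 2 + 4 * lam * z) ^ (1 / 2 : ℂ)) / (2 * lam)

/-- The Cauchy transform `G_μ`. -/
def cauchyTransform (μ : Measure ℝ) (z : ℂ) : ℂ := ∫ t : ℝ, 1 / (z - (t : ℂ)) ∂μ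

/-- The function `H_μ`. -/
def rectH (lam : ℝ) (μ : Measure ℝ) (z : ℂ) : ℂ :=
  lam * cauchyTransform μ (1 / sqrtUpper z) ^ 2 +
    (1 - lam) * sqrtUpper z * cauchyTransform μ (1 / sqrtUpper z)

/-- The truncated sector of nonzero `z` with `|arg z - π| < α` and `|z| < β`, where `arg z` is
taken in `[0, 2π)`. For `α < π` the first condition says that the principal argument of `-z` is
less than `α` in absolute value. -/
def sector (α β : ℝ) : Set ℂ := {z | z ≠ 0 ∧ |Complex.arg (-z)| < α ∧ ‖z‖ < β}

/-- `P` holds on a truncated sector of every opening `α ∈ (0, π)`. -/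
def OnSectors (P : ℂ → Prop) : Prop :=
  ∀ α : ℝ, 0 < α → α < Real.pi → ∃ β : ℝ, 0 < β ∧ ∀ z ∈ sector α β, P z

/-- `F` is analytic on a truncated sector of every opening `α ∈ (0, π)`. -/
def AnalyticOnSectors (F : ℂ → ℂ) : Prop :=
  ∀ α : ℝ, 0 < α → α < Real.pi → ∃ β : ℝ, 0 < β ∧ DifferentiableOn ℂ F (sector α β)

/-- `F` is the inverse of `H` for composition, as a germ at zero in the sectors: `F` is analytic
there, `F z / z → 1` as `z → 0` inside each sector, and `H ∘ F = F ∘ H = id` near zero. -/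
structure IsSectorInverse (H F : ℂ → ℂ) : Prop where
  analytic : AnalyticOnSectors F
  tangent : ∀ α : ℝ, 0 < α → α < Real.pi →
    Tendsto (fun z => F z / z) (𝓝[sector α 1] 0) (𝓝 1)
  right_inv : OnSectors fun z => H (F z) = z
  left_inv : OnSectors fun z => F (H z) = z

/-- `C` represents the germ at zero (in the sectors) of the rectangular `R`-transform of `μ`. -/
def IsRectR (lam : ℝ) (μ : Measure ℝ) (C : ℂ → ℂ) : Prop :=
  ∃ F : ℂ → ℂ, IsSectorInverse (rectH lam μ) F ∧
    OnSectors fun z => C z = rectU lam (z / F z - 1)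

/-! ## Rectangular free convolution and infinite divisibility -/

/-- `ρ` is the rectangular free convolution with ratio `lam` of `μ` and `ν`: the symmetric law
whose rectangular `R`-transform is the sum of those of `μ` and `ν`. -/
def IsRectConv (lam : ℝ) (μ ν ρ : Measure ℝ) : Prop :=
  IsSymmProb μ ∧ IsSymmProb ν ∧ IsSymmProb ρ ∧
    ∃ C D : ℂ → ℂ, IsRectR lam μ C ∧ IsRectR lam ν D ∧ IsRectR lam ρ (fun z => C z + D z)

/-- `ρ` is the `n`-fold rectangular free convolution power of `μ`. -/
def IsRectConvPow (lam : ℝ) (μ : Measure ℝ) : ℕ → Measure ℝ → Prop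
  | 0, ρ => ρ = Measure.dirac 0
  | n + 1, ρ => ∃ σ : Measure ℝ, IsRectConvPow lam μ n σ ∧ IsRectConv lam σ μ ρ

/-- Infinite divisibility for the rectangular free convolution with ratio `lam`. -/
def IsRectInfDiv (lam : ℝ) (ν : Measure ℝ) : Prop :=
  ∀ n : ℕ, 1 ≤ n → ∃ κ : Measure ℝ, IsSymmProb κ ∧ IsRectConvPow lam κ n ν

/-- `G` is the Lévy measure of the rectangularly infinitely divisible law `ν`. -/
def IsRectLevyMeasure (lam : ℝ) (ν G : Measure ℝ) : Prop :=
  IsSymmFinite G ∧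
    IsRectR lam ν fun z => z * ∫ t : ℝ, (1 + (t : ℂ) ^ 2) / (1 - z * (t : ℂ) ^ 2) ∂G

/-- `ν` is the image of `μ` by the rectangular Bercovici-Pata bijection with ratio `lam`: both laws
are symmetric, `μ` is infinitely divisible for the classical convolution and `ν` for the rectangular
free one, and they have the same Lévy measure. -/
structure IsRectBercoviciPata (lam : ℝ) (μ ν : Measure ℝ) : Prop where
  symm_left : IsSymmProb μ
  infDiv_left : IsInfDiv μ
  symm_right : IsSymmProb ν
  infDiv_right : IsRectInfDiv lam ν
  levy : ∃ G : Measure ℝ, IsLevyMeasure μ G ∧ IsRectLevyMeasure lam ν G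

/-! ## Free cumulants with ratio `lam` -/

/-- Partitions of `{1, …, m}`. -/
abbrev Part (m : ℕ) : Type := Finpartition (Finset.Icc 1 m)

/-- No two distinct blocks cross. -/
def IsNoncrossing {m : ℕ} (π : Part m) : Prop :=
  ∀ V ∈ π.parts, ∀ W ∈ π.parts, V ≠ W →
    ∀ a ∈ V, ∀ b ∈ W, ∀ c ∈ V, ∀ d ∈ W, ¬ (a < b ∧ b < c ∧ c < d)

open Classical in
/-- The noncrossing partitions of `{1, …, m}` all of whose blocks have even cardinality. -/
def evenNC (m : ℕ) : Finset (Part m) :=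
  Finset.univ.filter fun π => IsNoncrossing π ∧ ∀ V ∈ π.parts, Even V.card

open Classical in
/-- The number of blocks with even minimum. -/
def evenMinBlocks {m : ℕ} (π : Part m) : ℕ :=
  (π.parts.filter fun V => ∃ a ∈ V, Even a ∧ ∀ b ∈ V, a ≤ b).card

/-- `c n`, for `n ≥ 1`, is the free cumulant with ratio `lam` of order `2 n` of the law `μ`, which
has moments of all orders. -/
def IsRectCumulants (lam : ℝ) (μ : Measure ℝ) (c : ℕ → ℝ) : Prop :=
  (∀ k : ℕ, Integrable (fun x : ℝ => x ^ k) μ) ∧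
    ∀ n : ℕ, 1 ≤ n → ∫ x, x ^ (2 * n) ∂μ =
      ∑ π ∈ evenNC (2 * n), lam ^ evenMinBlocks π * ∏ V ∈ π.parts, c (V.card / 2)

/-! ## Explicit laws -/

open Classical in
/-- The density of the rectangular Gaussian law with ratio `lam > 0`. -/
def rectGaussianDensity (lam x : ℝ) : ℝ :=
  if x ^ 2 ∈ Set.Icc ((1 - √lam) ^ 2) ((1 + √lam) ^ 2) then
    √(4 * lam - (x ^ 2 - 1 - lam) ^ 2) / (2 * Real.pi * lam * |x|)
  else 0

open Classical in
/-- The density of the absolutely continuous part of the Marchenko-Pastur law. -/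
def marchenkoPasturDensity (c x : ℝ) : ℝ :=
  if x ∈ Set.Icc ((1 - √c) ^ 2) ((1 + √c) ^ 2) then
    √(4 * c - (x - 1 - c) ^ 2) / (2 * Real.pi * x)
  else 0

/-- The Marchenko-Pastur law with parameter `c > 0`; the atom is absent when `c ≥ 1`. -/
def marchenkoPastur (c : ℝ) : Measure ℝ :=
  ENNReal.ofReal (1 - c) • Measure.dirac 0 +
    volume.withDensity fun x => ENNReal.ofReal (marchenkoPasturDensity c x)

end

end RectFree

/-!
Write `m_μ(z) = ∫ 1 / (1 - z t²) dμ(t)` for a symmetric law `μ`. Averaging over `t` and `-t` gives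
`G_μ(1 / √z) = √z m_μ(z)`, so that `H_μ(z) = z (lam m_μ(z) + 1 - lam) m_μ(z)` (`rectH_eq`). Since
`rectU` inverts `X ↦ (lam X + 1) (X + 1) - 1`, the rectangular `R`-transform of `μ` is `z ↦ a z` if
and only if `H_μ` has the inverse `F_a(z) = z / ((lam a z + 1) (a z + 1))`, that is,
`m_μ(F_a(z)) = 1 + a z` near zero. For compactly supported laws this is
`isRectR_of_momentTransform`.

The only Lévy measure of `N(0, 1)` is `δ₀` (`eq_dirac_of_isLevyMeasure`), so `Λ(N(0, 1))` has to be
the law with rectangular `R`-transform `z ↦ z`.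

* Uniqueness (`isRectR_id_unique`): on the negative half-line the inversion says that
  `M = m_μ(-y) - 1` is the only root above `-1` of `M = -y (lam M + 1) (M + 1)`. Hence
  `∫ 1 / (1 + y t²) dμ(t)` is determined for small `y > 0`. Expanding it around some `y₀ > 0` gives
  all moments of the bounded function `y₀ t² / (1 + y₀ t²)`, and these determine a symmetric law.
* Existence: the substitution `u = 1 + lam + 2 √lam cos θ = |1 + √lam e^{iθ}|²` turns integrals of
  functions of `x²` against the explicit density into
  `(2 / π) ∫ f(u) sin² θ / u dθ` over `(0, π)`. The identity `m(F_1(w)) = 1 + w` reduces to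
  `∫ sin² θ / (1 + W² + 2 W cos θ) dθ = π / 2` with `W = -√lam w` (`integral_sin_sq_div`), which
  follows from the mean value property. For `lam = 0` the law `(δ₁ + δ₋₁) / 2` is checked directly.
  Scaling by `√(k / n)` gives the laws with transform `z ↦ (k / n) z`, whence infinite
  divisibility.
* Cumulants: `m(F_1(w)) = 1 + w` yields the recursion
  `a (n + 1) = lam ∑ a k a (n - k) + (1 - lam) a n` for the even moments (`moment_recursion`). The
  noncrossing pairings, weighted by the number of blocks with even minimum, satisfy the same
  recursion, by decomposition along the block of the least element (`pairingSum_Ico`). The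
  moment-cumulant relations are triangular, which gives the converse (`cumulants_unique`).
* The law of `x²` is compared with the Marchenko-Pastur law by the substitutions `u = x²` and
  `u = lam t`.
-/

namespace RectFree

noncomputable section

/-! ### The rectangular `R`-transform in terms of the even moments -/

/-- The generating function `z ↦ ∫ 1 / (1 - z t²) dμ(t)` of the even moments of `μ`. -/
def momentTransform (μ : Measure ℝ) (z : ℂ) : ℂ := ∫ t : ℝ, 1 / (1 - z * (t : ℂ) ^ 2) ∂μ

/-- The rational function `z ↦ z / ((lam a z + 1) (a z + 1))`. It is the compositional inverse of
`H_μ` exactly when the rectangular `R`-transform of `μ` is `z ↦ a z`. -/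
def ratInv (lam a : ℝ) (z : ℂ) : ℂ := z / ((lam * (a * z) + 1) * (a * z + 1))

lemma sqrtUpper_sq (z : ℂ) : sqrtUpper z ^ 2 = z := by
  have h : ((-z) ^ (1 / 2 : ℂ)) ^ 2 = -z := by
    simp [one_div]
  rw [sqrtUpper, mul_pow, Complex.I_sq, h]
  ring

lemma sqrtUpper_ne_zero {z : ℂ} (hz : z ≠ 0) : sqrtUpper z ≠ 0 := by
  intro h
  apply hz
  rw [← sqrtUpper_sq z, h]
  simp

/-- Averaging over `t` and `-t` expresses the Cauchy transform of a symmetric law at `1 / s`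
through the generating function of its even moments at `s ^ 2`. -/
lemma cauchyTransform_one_div {μ : Measure ℝ} [IsFiniteMeasure μ] [μ.IsNegInvariant] {s : ℂ}
    (hs : s ≠ 0) {c : ℝ} (hc : 0 < c)
    (h : ∀ᵐ t : ℝ ∂μ, c ≤ ‖1 - s * t‖ ∧ c ≤ ‖1 + s * t‖) :
    cauchyTransform μ (1 / s) = s * momentTransform μ (s ^ 2) := by
  have key : ∀ᵐ t : ℝ ∂μ, 1 - s * t ≠ 0 ∧ 1 + s * t ≠ 0 := by
    filter_upwards [h] with t ht
    exact ⟨norm_pos_iff.1 (hc.trans_le ht.1), norm_pos_iff.1 (hc.trans_le ht.2)⟩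
  have e1 : cauchyTransform μ (1 / s) = ∫ t : ℝ, s / (1 - s * t) ∂μ := by
    refine integral_congr_ae ?_
    filter_upwards [key] with t ht
    have h1 := ht.1
    have : (1 / s - (t : ℂ)) = (1 - s * t) / s := by field_simp
    rw [this, one_div_div]
  have e2 : ∫ t : ℝ, s / (1 - s * t) ∂μ = ∫ t : ℝ, s / (1 + s * t) ∂μ := by
    rw [← integral_neg_eq_self]
    refine integral_congr_ae (Eventually.of_forall fun t => ?_)
    simp
  have i1 : Integrable (fun t : ℝ => s / (1 - s * t)) μ := by
    refine Integrable.of_bound (C := ‖s‖ / c)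
      (Measurable.aestronglyMeasurable (by fun_prop)) ?_
    filter_upwards [h] with t ht
    rw [norm_div]
    gcongr
    exact ht.1
  have i2 : Integrable (fun t : ℝ => s / (1 + s * t)) μ := by
    refine Integrable.of_bound (C := ‖s‖ / c)
      (Measurable.aestronglyMeasurable (by fun_prop)) ?_
    filter_upwards [h] with t ht
    rw [norm_div]
    gcongr
    exact ht.2
  have e3 : 2 * cauchyTransform μ (1 / s) = 2 * (s * momentTransform μ (s ^ 2)) := by
    rw [two_mul]
    nth_rewrite 2 [e1]
    rw [e2, e1, ← integral_add i1 i2, momentTransform, ← integral_const_mul, ← integral_const_mul]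
    refine integral_congr_ae ?_
    filter_upwards [key] with t ht
    obtain ⟨h1, h2⟩ := ht
    have h3 : 1 - s ^ 2 * (t : ℂ) ^ 2 ≠ 0 := by
      have : 1 - s ^ 2 * (t : ℂ) ^ 2 = (1 - s * t) * (1 + s * t) := by ring
      rw [this]; exact mul_ne_zero h1 h2
    field_simp
    ring
  exact mul_left_cancel₀ two_ne_zero e3

/-- With `c = 1` and `z < 0` the hypothesis holds for every symmetric law, because `√z` is then
imaginary. -/
lemma rectH_eq {μ : Measure ℝ} [IsFiniteMeasure μ] [μ.IsNegInvariant] (lam : ℝ) {z : ℂ}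
    (hz : z ≠ 0) {c : ℝ} (hc : 0 < c)
    (h : ∀ᵐ t : ℝ ∂μ, c ≤ ‖1 - sqrtUpper z * t‖ ∧ c ≤ ‖1 + sqrtUpper z * t‖) :
    rectH lam μ z = z * (lam * momentTransform μ z + (1 - lam)) * momentTransform μ z := by
  rw [rectH, cauchyTransform_one_div (sqrtUpper_ne_zero hz) hc h, mul_pow, sqrtUpper_sq,
    mul_assoc _ (sqrtUpper z), ← mul_assoc (sqrtUpper z), ← pow_two, sqrtUpper_sq]
  ring

/-- For a compactly supported law the formula for `H_μ` holds in a punctured disc. -/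
lemma eventually_rectH_eq {μ : Measure ℝ} [IsFiniteMeasure μ] [μ.IsNegInvariant] (lam : ℝ) {R : ℝ}
    (hR : ∀ᵐ t : ℝ ∂μ, |t| ≤ R) : ∀ᶠ z in 𝓝 (0 : ℂ), z ≠ 0 →
      rectH lam μ z = z * (lam * momentTransform μ z + (1 - lam)) * momentTransform μ z := by
  have h1 : ∀ᶠ z in 𝓝 (0 : ℂ), ‖z‖ * R ^ 2 < 1 / 4 := by
    have : Tendsto (fun z : ℂ => ‖z‖ * R ^ 2) (𝓝 0) (𝓝 (‖(0 : ℂ)‖ * R ^ 2)) :=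
      (by fun_prop : Continuous fun z : ℂ => ‖z‖ * R ^ 2).tendsto _
    exact this.eventually_lt_const (by simp)
  filter_upwards [h1] with z hz hz0
  refine rectH_eq lam hz0 (c := 1 / 2) (by norm_num) ?_
  filter_upwards [hR] with t ht
  have h2 : ‖sqrtUpper z * t‖ ≤ 1 / 2 := by
    refine abs_le_of_sq_le_sq' ?_ (by norm_num) |>.2
    rw [norm_mul, mul_pow, ← norm_pow, sqrtUpper_sq, Complex.norm_real, Real.norm_eq_abs]
    have : |t| ^ 2 ≤ R ^ 2 := by gcongr
    nlinarith [norm_nonneg z]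
  have h3 := norm_sub_norm_le (1 : ℂ) (sqrtUpper z * t)
  have h4 := norm_sub_norm_le (1 : ℂ) (-(sqrtUpper z * t))
  rw [norm_neg, sub_neg_eq_add] at h4
  rw [norm_one] at h3 h4
  constructor <;> linarith

lemma OnSectors.of_eventually {P : ℂ → Prop} (h : ∀ᶠ z in 𝓝 (0 : ℂ), z ≠ 0 → P z) :
    OnSectors P := by
  intro α _ _
  obtain ⟨β, hβ, hP⟩ := Metric.eventually_nhds_iff.1 h
  exact ⟨β, hβ, fun z hz => hP (by simpa using hz.2.2) hz.1⟩

lemma rectU_add_one_mul (lam : ℝ) (z : ℂ) :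
    (lam * rectU lam z + 1) * (rectU lam z + 1) = z + 1 := by
  by_cases h : lam = 0
  · simp [rectU, h]
  have hl : (lam : ℂ) ≠ 0 := by exact_mod_cast h
  rw [rectU, if_neg h]
  set q := (((lam : ℂ) + 1) ^ 2 + 4 * lam * z) ^ (1 / 2 : ℂ) with hq
  have h2 : q ^ 2 = ((lam : ℂ) + 1) ^ 2 + 4 * lam * z := by
    simp [hq, one_div]
  field_simp
  linear_combination h2

/-- The principal square root of `(lam + 1 + 2 lam x)²` is the expected one for small `x`. -/
lemma eventually_rectU_eq {lam : ℝ} (hlam : 0 ≤ lam) : ∀ᶠ x in 𝓝 (0 : ℂ),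
    rectU lam ((lam * x + 1) * (x + 1) - 1) = x := by
  by_cases h : lam = 0
  · exact Eventually.of_forall fun x => by simp [rectU, h]
  have hl : (lam : ℂ) ≠ 0 := by exact_mod_cast h
  have h1 : ∀ᶠ x in 𝓝 (0 : ℂ), 0 < ((lam : ℂ) + 1 + 2 * lam * x).re := by
    have : Tendsto (fun x : ℂ => ((lam : ℂ) + 1 + 2 * lam * x).re) (𝓝 0)
        (𝓝 ((lam : ℂ) + 1 + 2 * lam * 0).re) :=
      (by fun_prop : Continuous fun x : ℂ => ((lam : ℂ) + 1 + 2 * lam * x).re).tendsto _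
    refine this.eventually_const_lt ?_
    simp
    linarith
  filter_upwards [h1] with x hx
  rw [rectU, if_neg h]
  have e : ((lam : ℂ) + 1) ^ 2 + 4 * lam * ((lam * x + 1) * (x + 1) - 1) =
      ((lam : ℂ) + 1 + 2 * lam * x) ^ 2 := by ring
  have e2 : (((lam : ℂ) + 1 + 2 * lam * x) ^ 2) ^ (1 / 2 : ℂ) = (lam : ℂ) + 1 + 2 * lam * x := by
    have := Complex.pow_cpow_nat_inv (x := (lam : ℂ) + 1 + 2 * lam * x) (two_ne_zero)
      (by
        have := (Complex.abs_arg_lt_pi_div_two_iff.2 (Or.inl hx))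
        rw [abs_lt] at this
        push_cast
        linarith [this.1])
      (by
        have := (Complex.abs_arg_lt_pi_div_two_iff.2 (Or.inl hx))
        rw [abs_lt] at this
        push_cast
        linarith [this.2])
    simpa [one_div] using this
  rw [e, e2]
  field_simp
  ring

lemma hasStrictDerivAt_ratInv (lam a : ℝ) : HasStrictDerivAt (ratInv lam a) 1 0 := by
  have h1 : HasStrictDerivAt (fun z : ℂ => (lam * (a * z) + 1) * (a * z + 1))
      (deriv (fun z : ℂ => (lam * (a * z) + 1) * (a * z + 1)) 0) 0 :=
    ContDiffAt.hasStrictDerivAt (n := 1) (by fun_prop) (by simp)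
  have := (hasStrictDerivAt_id (0 : ℂ)).div h1 (by simp)
  have e : ratInv lam a = id / fun z : ℂ => (lam * (a * z) + 1) * (a * z + 1) := rfl
  rw [e]
  simpa using this

/-- `ratInv lam a` is a local homeomorphism at zero, having derivative `1` there. -/
lemma map_ratInv_nhds (lam a : ℝ) : map (ratInv lam a) (𝓝 0) = 𝓝 0 := by
  have := (hasStrictDerivAt_ratInv lam a).map_nhds_eq one_ne_zero
  simpa [ratInv] using this

lemma eventually_denom_ne_zero (lam a : ℝ) :
    ∀ᶠ z : ℂ in 𝓝 0, ((lam : ℂ) * (a * z) + 1) * (a * z + 1) ≠ 0 :=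
  ContinuousAt.eventually_ne (by fun_prop) (by simp)

/-- A compactly supported symmetric law `μ` with `m_μ(F(z)) = 1 + a z` near zero, where
`F(z) = z / ((lam a z + 1) (a z + 1))`, has rectangular `R`-transform `z ↦ a z`. -/
lemma isRectR_of_momentTransform {lam a R : ℝ} (hlam : 0 ≤ lam) {μ : Measure ℝ}
    (hμ : IsSymmProb μ) (hR : ∀ᵐ t : ℝ ∂μ, |t| ≤ R)
    (hm : ∀ᶠ z in 𝓝 (0 : ℂ), momentTransform μ (ratInv lam a z) = 1 + a * z) :
    IsRectR lam μ (fun z => a * z) := by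
  have := hμ.prob
  have := hμ.symm
  have hmap := map_ratInv_nhds lam a
  have htend : Tendsto (ratInv lam a) (𝓝 0) (𝓝 0) := hmap.le
  have hden := eventually_denom_ne_zero lam a
  have hright : ∀ᶠ z in 𝓝 (0 : ℂ), z ≠ 0 → rectH lam μ (ratInv lam a z) = z := by
    filter_upwards [htend.eventually (eventually_rectH_eq lam hR), hm, hden] with z h1 h2 h3 hz
    rw [h1 (div_ne_zero hz h3), h2, ratInv, div_mul_eq_mul_div, div_mul_eq_mul_div,
      div_eq_iff h3]
    ring
  refine ⟨ratInv lam a, ⟨?_, ?_, .of_eventually hright, .of_eventually ?_⟩, .of_eventually ?_⟩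
  · intro α _ _
    obtain ⟨β, hβ, hP⟩ := Metric.eventually_nhds_iff.1 hden
    refine ⟨β, hβ, fun z hz => DifferentiableAt.differentiableWithinAt ?_⟩
    have h0 : (lam * (a * z) + 1) * (a * z + 1) ≠ 0 := hP (by simpa using hz.2.2)
    unfold ratInv
    exact DifferentiableAt.div (by fun_prop) (by fun_prop) h0
  · intro α _ _
    have h1 : Tendsto (fun z : ℂ => 1 / ((lam * (a * z) + 1) * (a * z + 1))) (𝓝 0) (𝓝 1) := by
      have : ContinuousAt (fun z : ℂ => 1 / ((lam * (a * z) + 1) * (a * z + 1))) 0 :=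
        ContinuousAt.div (by fun_prop) (by fun_prop) (by simp)
      simpa [ContinuousAt] using this
    refine (h1.mono_left nhdsWithin_le_nhds).congr' ?_
    filter_upwards [self_mem_nhdsWithin] with z hz
    have := hz.1
    rw [ratInv]
    field_simp
  · -- `F` is open at zero, so every small `z` is some `F w`, and there `H (F w) = w`.
    rw [← hmap, eventually_map]
    filter_upwards [hright] with z hz hz0
    have : z ≠ 0 := fun h => hz0 (by simp [h, ratInv])
    rw [hz this]
  · have h1 : Tendsto (fun z : ℂ => a * z) (𝓝 0) (𝓝 0) := by
      have : ContinuousAt (fun z : ℂ => a * z) 0 := by fun_prop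
      simpa [ContinuousAt] using this
    filter_upwards [h1.eventually (eventually_rectU_eq hlam), hden] with z h2 h3 hz
    have : z / ratInv lam a z = (lam * (a * z) + 1) * (a * z + 1) := by
      rw [ratInv]
      field_simp
    rw [this, h2]

/-! ### Coefficients of power series -/

/-- A power series with vanishing sum near zero has vanishing coefficients. -/
lemma coeff_eq_zero_of_eventually_hasSum {𝕜 : Type*} [NontriviallyNormedField 𝕜] {b : ℕ → 𝕜}
    (h : ∀ᶠ z in 𝓝 (0 : 𝕜), HasSum (fun n => z ^ n * b n) 0) : b = 0 := by
  let p : FormalMultilinearSeries 𝕜 𝕜 𝕜 := fun n => ContinuousMultilinearMap.mkPiRing 𝕜 (Fin n) (b n)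
  have hp : HasFPowerSeriesAt (fun _ : 𝕜 => (0 : 𝕜)) p 0 := by
    rw [hasFPowerSeriesAt_iff]
    simpa [p, FormalMultilinearSeries.coeff] using h
  have h0 := hp.eq_zero
  funext n
  have := congrArg (fun q => FormalMultilinearSeries.coeff q n) h0
  simpa [p, FormalMultilinearSeries.coeff] using this

/-! ### The Lévy measure of the Gaussian law -/

lemma abs_levyKernel_le (ξ t : ℝ) : |levyKernel ξ t| ≤ ξ ^ 2 + 4 := by
  unfold levyKernel
  split_ifs with h
  · rw [abs_neg, abs_of_nonneg (by positivity)]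
    nlinarith [sq_nonneg ξ]
  · have ht : 0 < t ^ 2 := by positivity
    have h1 := Real.one_sub_sq_div_two_le_cos (x := t * ξ)
    have h2 := Real.cos_le_one (t * ξ)
    have h3 := Real.neg_one_le_cos (t * ξ)
    rw [abs_mul, abs_of_nonpos (by linarith), abs_of_nonneg (by positivity), ← mul_div_assoc,
      div_le_iff₀ ht]
    nlinarith [sq_nonneg ξ]

lemma measurable_levyKernel (ξ : ℝ) : Measurable (levyKernel ξ) := by
  unfold levyKernel
  exact Measurable.ite (measurableSet_singleton 0) (by fun_prop) (by fun_prop)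

lemma integrable_levyKernel (ξ : ℝ) (G : Measure ℝ) [IsFiniteMeasure G] :
    Integrable (levyKernel ξ) G :=
  Integrable.of_bound (measurable_levyKernel ξ).aestronglyMeasurable (ξ ^ 2 + 4)
    (Eventually.of_forall fun t => abs_levyKernel_le ξ t)

lemma levyKernel_two_mul_sub {ξ t : ℝ} (ht : t ≠ 0) : levyKernel (2 * ξ) t - 4 * levyKernel ξ t =
    2 * (1 - Real.cos (t * ξ)) ^ 2 * ((1 + t ^ 2) / t ^ 2) := by
  have h : t * (2 * ξ) = 2 * (t * ξ) := by ring
  simp only [levyKernel, if_neg ht, h, Real.cos_two_mul]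
  ring

/-- The only Lévy measure of the standard Gaussian law is the Dirac mass at zero: the combination
`levyKernel (2 ξ) - 4 levyKernel ξ` is nonnegative with zero integral, which forces `cos (t ξ) = 1`
for almost every `t ≠ 0`, and no `t ≠ 0` satisfies this for both `ξ = 1` and `ξ = √2`. -/
lemma eq_dirac_of_isLevyMeasure {G : Measure ℝ} (h : IsLevyMeasure (gaussianReal 0 1) G) :
    G = Measure.dirac 0 := by
  obtain ⟨⟨hfin, -⟩, h⟩ := h
  have hint (ξ : ℝ) : ∫ t, levyKernel ξ t ∂G = -(ξ ^ 2 / 2) := by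
    have h1 := h ξ
    rw [charFun_gaussianReal, ← sub_eq_zero] at h1
    have h2 : Complex.exp ((-(ξ ^ 2 / 2) : ℝ) : ℂ) =
        Complex.exp ((∫ t, levyKernel ξ t ∂G : ℝ) : ℂ) := by
      rw [← sub_eq_zero, ← h1]
      congr 2
      push_cast
      simp
    rw [← Complex.ofReal_exp, ← Complex.ofReal_exp, Complex.ofReal_inj] at h2
    exact (Real.exp_injective h2).symm
  have hcos (ξ : ℝ) : ∀ᵐ t ∂G, t ≠ 0 → Real.cos (t * ξ) = 1 := by
    have i1 := integrable_levyKernel (2 * ξ) G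
    have i2 := (integrable_levyKernel ξ G).const_mul 4
    have h0 : ∫ t, (levyKernel (2 * ξ) t - 4 * levyKernel ξ t) ∂G = 0 := by
      rw [integral_sub i1 i2, integral_const_mul, hint, hint]
      ring
    have hnn : 0 ≤ fun t => levyKernel (2 * ξ) t - 4 * levyKernel ξ t := by
      intro t
      by_cases ht : t = 0
      · simp [levyKernel, ht]
        linarith
      · simp only [Pi.zero_apply]
        rw [levyKernel_two_mul_sub ht]
        positivity
    have h1 := (integral_eq_zero_iff_of_nonneg hnn (i1.sub i2)).1 h0
    filter_upwards [h1] with t ht ht0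
    rw [levyKernel_two_mul_sub ht0] at ht
    have : (1 + t ^ 2) / t ^ 2 ≠ 0 := by positivity
    have h3 : 1 - Real.cos (t * ξ) = 0 := by simpa [this] using ht
    linarith
  have hzero : ∀ᵐ t ∂G, t = 0 := by
    filter_upwards [hcos 1, hcos (√2)] with t h1 h2
    by_contra ht
    obtain ⟨k, hk⟩ := (Real.cos_eq_one_iff _).1 (h1 ht)
    obtain ⟨l, hl⟩ := (Real.cos_eq_one_iff _).1 (h2 ht)
    have hk0 : (k : ℝ) ≠ 0 := by
      rintro hk'
      rw [hk'] at hk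
      apply ht
      linarith
    have : √2 = (l : ℝ) / k := by
      rw [eq_div_iff hk0]
      have hpi : (2 * Real.pi) ≠ 0 := by positivity
      apply mul_right_cancel₀ hpi
      rw [hl, mul_assoc, hk]
      ring
    exact irrational_sqrt_two ⟨(l : ℚ) / k, by rw [this]; push_cast; rfl⟩
  have hG : G = G Set.univ • Measure.dirac 0 := by
    have h1 : G.map (fun _ => (0 : ℝ)) = G.map id := Measure.map_congr <| by
      filter_upwards [hzero] with t ht using ht.symm
    rw [Measure.map_const, Measure.map_id] at h1
    exact h1.symm
  have h2 := hint 1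
  rw [hG, integral_smul_measure, integral_dirac] at h2
  have h3 : (G Set.univ).toReal = 1 := by
    simp [levyKernel] at h2
    linarith
  rw [hG, (ENNReal.toReal_eq_one_iff _).1 h3, one_smul]

lemma isLevyMeasure_gaussianReal : IsLevyMeasure (gaussianReal 0 1) (Measure.dirac 0) := by
  refine ⟨⟨inferInstance, ⟨?_⟩⟩, fun ξ => ?_⟩
  · rw [Measure.neg, Measure.map_dirac' measurable_neg, neg_zero]
  · rw [charFun_gaussianReal, integral_dirac, levyKernel, if_pos rfl]
    congr 1
    push_cast
    simp

/-! ### The transform determines the law -/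

/-- If the rectangular `R`-transform of `μ` is `z ↦ z`, then `M = m_μ(-y) - 1` solves
`M = -y (lam M + 1) (M + 1)` for small `y > 0`. -/
lemma momentTransform_neg_of_isRectR {lam : ℝ} (hlam0 : 0 ≤ lam) (hlam1 : lam ≤ 1) {μ : Measure ℝ}
    (hμ : IsSymmProb μ) (h : IsRectR lam μ (fun z => z)) :
    ∃ β : ℝ, 0 < β ∧ ∀ y : ℝ, 0 < y → y < β → ∃ M : ℝ, M = (∫ t, 1 / (1 + y * t ^ 2) ∂μ) - 1 ∧
      -1 < M ∧ M = -y * (lam * M + 1) * (M + 1) := by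
  have := hμ.prob
  have := hμ.symm
  obtain ⟨F, hF, hC⟩ := h
  -- Only negative real arguments are needed, so the sectors of opening `π / 2` suffice.
  obtain ⟨β₁, hβ₁, hinv⟩ := hF.left_inv (Real.pi / 2) (by positivity) (by linarith [Real.pi_pos])
  obtain ⟨β₂, hβ₂, hC⟩ := hC (Real.pi / 2) (by positivity) (by linarith [Real.pi_pos])
  refine ⟨min 1 (min β₁ β₂), by positivity, fun y hy hyβ => ?_⟩
  simp only [lt_min_iff] at hyβ
  obtain ⟨hy1, hyβ₁, hyβ₂⟩ := hyβ
  have hsec {x β : ℝ} (hx : 0 < x) (hxβ : x < β) : ((-x : ℝ) : ℂ) ∈ sector (Real.pi / 2) β := by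
    refine ⟨by exact_mod_cast (neg_neg_of_pos hx).ne, ?_, ?_⟩
    · push_cast
      rw [neg_neg, Complex.arg_ofReal_of_nonneg hx.le, abs_zero]
      positivity
    · rwa [Complex.norm_real, norm_neg, Real.norm_of_nonneg hx.le]
  set m : ℝ := ∫ t, 1 / (1 + y * t ^ 2) ∂μ with hm
  have hint : Integrable (fun t : ℝ => 1 / (1 + y * t ^ 2)) μ := by
    refine Integrable.of_bound (C := 1) (Measurable.aestronglyMeasurable (by fun_prop))
      (Eventually.of_forall fun t => ?_)
    rw [Real.norm_of_nonneg (by positivity), div_le_one (by positivity)]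
    nlinarith [sq_nonneg t]
  have hm0 : 0 < m := by
    rw [hm, integral_pos_iff_support_of_nonneg (fun t => by positivity) hint]
    have : Function.support (fun t : ℝ => 1 / (1 + y * t ^ 2)) = Set.univ := by
      ext t
      have : 1 / (1 + y * t ^ 2) ≠ 0 := by positivity
      simpa using this
    rw [this]
    simp
  have hm1 : m ≤ 1 := by
    have := integral_mono hint (integrable_const (1 : ℝ)) (fun t => by
      change 1 / (1 + y * t ^ 2) ≤ 1
      rw [div_le_one (by positivity)]
      nlinarith [sq_nonneg t])
    simpa [hm] using this
  have hmc : momentTransform μ ((-y : ℝ) : ℂ) = m := by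
    rw [hm, momentTransform, ← integral_complex_ofReal]
    refine integral_congr_ae (Eventually.of_forall fun t => ?_)
    push_cast
    ring
  have hy0 : ((-y : ℝ) : ℂ) ≠ 0 := by exact_mod_cast (neg_neg_of_pos hy).ne
  have hH : rectH lam μ ((-y : ℝ) : ℂ) = ((-(y * (lam * m + (1 - lam)) * m) : ℝ) : ℂ) := by
    have hs : sqrtUpper ((-y : ℝ) : ℂ) = Complex.I * ((√y : ℝ) : ℂ) := by
      rw [sqrtUpper, Real.sqrt_eq_rpow, Complex.ofReal_cpow hy.le]
      push_cast
      rw [neg_neg]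
    rw [rectH_eq lam hy0 one_pos ?_, hmc]
    · push_cast
      ring
    · refine Eventually.of_forall fun t => ?_
      rw [hs]
      constructor
      · refine le_trans ?_ (Complex.abs_re_le_norm _)
        simp
      · refine le_trans ?_ (Complex.abs_re_le_norm _)
        simp
  set h : ℝ := y * (lam * m + (1 - lam)) * m with hh
  -- `H_μ(-y) = -h` with `0 < h ≤ y`, so that `H_μ(-y)` lies in the sectors as well.
  have hl : 0 < lam * m + (1 - lam) := by
    rcases hlam0.eq_or_lt with h | h
    · simp [← h]
    · nlinarith
  have hh0 : 0 < h := by positivity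
  have hhy : h ≤ y := by
    have : lam * m + (1 - lam) ≤ 1 := by nlinarith
    calc h ≤ y * 1 * 1 := by rw [hh]; gcongr
      _ = y := by ring
  have hFh : F ((-h : ℝ) : ℂ) = ((-y : ℝ) : ℂ) := by
    rw [← hH]
    exact hinv _ (hsec hy hyβ₁)
  have hU := hC _ (hsec hh0 (hhy.trans_lt hyβ₂))
  have hU2 := rectU_add_one_mul lam (((-h : ℝ) : ℂ) / F ((-h : ℝ) : ℂ) - 1)
  rw [← hU, hFh] at hU2
  have hU3 : (lam * (-h) + 1) * (-h + 1) = -h / -y := by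
    have : (((lam * (-h) + 1) * (-h + 1) : ℝ) : ℂ) = ((-h / -y : ℝ) : ℂ) := by
      push_cast at hU2 ⊢
      rw [hU2]
      ring
    exact_mod_cast this
  have hU4 : (lam * (-h) + 1) * (-h + 1) = (lam * (m - 1) + 1) * (m - 1 + 1) := by
    rw [hU3, neg_div_neg_eq, hh]
    field_simp
    ring
  -- `X ↦ (lam X + 1) (X + 1)` takes the same value at `-h` and `m - 1`, and is injective there.
  have hX : -h = m - 1 := by
    have h1 : (-h - (m - 1)) * (lam * (-h + (m - 1)) + 1 + lam) = 0 := by linear_combination hU4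
    have h2 : 0 < lam * (-h + (m - 1)) + 1 + lam := by
      rcases hlam0.eq_or_lt with h | h
      · simp [← h]
      · nlinarith
    have := (mul_eq_zero.1 h1).resolve_right h2.ne'
    linarith
  refine ⟨m - 1, rfl, by linarith, ?_⟩
  linear_combination -hX - hh

/-- The quadratic equation has at most one root above `-1`. -/
lemma root_unique {lam y M N : ℝ} (hlam0 : 0 ≤ lam) (hlam1 : lam ≤ 1) (hy : 0 < y) (hM : -1 < M)
    (hN : -1 < N) (h1 : M = -y * (lam * M + 1) * (M + 1)) (h2 : N = -y * (lam * N + 1) * (N + 1)) :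
    M = N := by
  have h : (M - N) * (1 + y * (lam * (M + N) + 1 + lam)) = 0 := by linear_combination h1 - h2
  have h3 : 0 ≤ lam * (M + N) + 1 + lam := by nlinarith
  have h4 : 0 < 1 + y * (lam * (M + N) + 1 + lam) := by positivity
  exact sub_eq_zero.1 ((mul_eq_zero.1 h).resolve_right h4.ne')

/-- Expansion of `∫ f / (1 - r g) dμ` in powers of `r`. -/
lemma hasSum_integral_div_one_sub {μ : Measure ℝ} [IsFiniteMeasure μ] {f g : ℝ → ℝ}
    (hf : Measurable f) (hg : Measurable g) {A B r : ℝ} (hfA : ∀ᵐ t ∂μ, |f t| ≤ A)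
    (hgB : ∀ᵐ t ∂μ, |g t| ≤ B) (hB : 0 ≤ B) (hr : |r| * B < 1) :
    HasSum (fun k => r ^ k * ∫ t, f t * g t ^ k ∂μ) (∫ t, f t / (1 - r * g t) ∂μ) := by
  have hbd (k : ℕ) : ∀ᵐ t ∂μ, ‖f t * (r * g t) ^ k‖ ≤ A * (|r| * B) ^ k := by
    filter_upwards [hfA, hgB] with t h1 h2
    rw [norm_mul, norm_pow, norm_mul, Real.norm_eq_abs, Real.norm_eq_abs, Real.norm_eq_abs]
    have : 0 ≤ A := (abs_nonneg _).trans h1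
    gcongr
  have hint (k : ℕ) : Integrable (fun t => f t * (r * g t) ^ k) μ :=
    Integrable.of_bound (Measurable.aestronglyMeasurable (by fun_prop)) _ (hbd k)
  have hsum : Summable fun k => ∫ t, ‖f t * (r * g t) ^ k‖ ∂μ := by
    refine Summable.of_nonneg_of_le (fun k => integral_nonneg fun t => norm_nonneg _)
      (fun k => integral_mono_ae (hint k).norm (integrable_const _) (hbd k)) ?_
    simp only [integral_const, smul_eq_mul]
    exact ((summable_geometric_of_lt_one (by positivity) hr).mul_left A).mul_left _
  have key := hasSum_integral_of_summable_integral_norm hint hsum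
  have e1 (k : ℕ) : r ^ k * ∫ t, f t * g t ^ k ∂μ = ∫ t, f t * (r * g t) ^ k ∂μ := by
    rw [← integral_const_mul]
    congr 1
    funext t
    ring
  have e2 : ∫ t, f t / (1 - r * g t) ∂μ = ∫ t, ∑' k, f t * (r * g t) ^ k ∂μ := by
    refine integral_congr_ae ?_
    filter_upwards [hgB] with t ht
    have : |r * g t| < 1 := by
      rw [abs_mul]
      exact lt_of_le_of_lt (by gcongr) hr
    rw [tsum_mul_left, tsum_geometric_of_abs_lt_one this, div_eq_mul_inv]
  simp only [e1, e2]
  exact key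

/-- The law of a bounded function is determined by its moments. -/
lemma map_eq_of_integral_pow_eq {μ ν : Measure ℝ} [IsProbabilityMeasure μ] [IsProbabilityMeasure ν]
    {g : ℝ → ℝ} (hg : Measurable g) (hb : ∀ t, |g t| ≤ 1)
    (h : ∀ k : ℕ, ∫ t, g t ^ k ∂μ = ∫ t, g t ^ k ∂ν) : μ.map g = ν.map g := by
  have : IsProbabilityMeasure (μ.map g) := Measure.isProbabilityMeasure_map hg.aemeasurable
  have : IsProbabilityMeasure (ν.map g) := Measure.isProbabilityMeasure_map hg.aemeasurable
  have key (κ : Measure ℝ) [IsProbabilityMeasure κ] (x : ℝ) :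
      HasSum (fun k : ℕ => ((x : ℂ) * Complex.I) ^ k / (k.factorial : ℂ) * (∫ t, g t ^ k ∂κ : ℝ))
        (charFun (κ.map g) x) := by
    have hbd (k : ℕ) (t : ℝ) :
        ‖((x * g t : ℂ) * Complex.I) ^ k / (k.factorial : ℂ)‖ ≤ |x| ^ k / k.factorial := by
      rw [norm_div, norm_pow, norm_mul, norm_mul, Complex.norm_real, Complex.norm_real,
        Complex.norm_I, mul_one, Complex.norm_natCast, Real.norm_eq_abs, Real.norm_eq_abs]
      gcongr
      exact mul_le_of_le_one_right (abs_nonneg _) (hb t)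
    have hint (k : ℕ) : Integrable
        (fun t => ((x * g t : ℂ) * Complex.I) ^ k / (k.factorial : ℂ)) κ :=
      Integrable.of_bound (Measurable.aestronglyMeasurable (by fun_prop)) _
        (Eventually.of_forall (hbd k))
    have hsum : Summable fun k : ℕ =>
        ∫ t, ‖((x * g t : ℂ) * Complex.I) ^ k / (k.factorial : ℂ)‖ ∂κ := by
      refine Summable.of_nonneg_of_le (fun k => integral_nonneg fun t => norm_nonneg _)
        (fun k => integral_mono (hint k).norm (integrable_const _) (hbd k)) ?_
      simpa using Real.summable_pow_div_factorial |x|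
    have h1 := hasSum_integral_of_summable_integral_norm hint hsum
    have e1 (k : ℕ) : ((x : ℂ) * Complex.I) ^ k / (k.factorial : ℂ) * (∫ t, g t ^ k ∂κ : ℝ) =
        ∫ t, ((x * g t : ℂ) * Complex.I) ^ k / (k.factorial : ℂ) ∂κ := by
      rw [← integral_complex_ofReal, ← integral_const_mul]
      congr 1
      funext t
      push_cast
      ring
    have e2 : charFun (κ.map g) x =
        ∫ t, ∑' k : ℕ, ((x * g t : ℂ) * Complex.I) ^ k / (k.factorial : ℂ) ∂κ := by
      rw [charFun_apply_real, integral_map hg.aemeasurable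
        (Measurable.aestronglyMeasurable (by fun_prop))]
      congr 1
      funext t
      rw [Complex.exp_eq_exp_ℂ, NormedSpace.exp_eq_tsum_div]
    simp only [e1, e2]
    exact h1
  refine Measure.ext_of_charFun ?_
  funext x
  refine (key μ x).unique ?_
  simp_rw [h]
  exact key ν x

/-- A symmetric law is determined by the law of the absolute value. -/
lemma eq_of_map_abs_eq {μ ν : Measure ℝ} [μ.IsNegInvariant] [ν.IsNegInvariant]
    (h : μ.map (fun t => |t|) = ν.map (fun t => |t|)) : μ = ν := by
  have key (κ : Measure ℝ) [κ.IsNegInvariant] {s : Set ℝ} (hs : MeasurableSet s) :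
      2 * κ s = ∫⁻ t, (s.indicator 1 t + s.indicator 1 (-t)) ∂(κ.map (fun t => |t|)) := by
    have hm : Measurable fun t : ℝ => s.indicator (1 : ℝ → ENNReal) t :=
      measurable_one.indicator hs
    have hm' : Measurable fun t : ℝ => s.indicator (1 : ℝ → ENNReal) (-t) := hm.comp measurable_neg
    have hadd : Measurable fun t : ℝ => s.indicator (1 : ℝ → ENNReal) t + s.indicator 1 (-t) :=
      hm.add hm'
    rw [lintegral_map hadd (by fun_prop)]
    have e : ∀ t : ℝ, s.indicator (1 : ℝ → ENNReal) |t| + s.indicator 1 (-|t|) =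
        s.indicator 1 t + s.indicator 1 (-t) := by
      intro t
      rcases abs_choice t with ht | ht <;> rw [ht]
      rw [neg_neg, add_comm]
    simp_rw [e]
    rw [lintegral_add_left hm, lintegral_neg_eq_self, lintegral_indicator_one hs, two_mul]
  ext s hs
  have := key μ hs
  rw [h, ← key ν hs] at this
  exact (ENNReal.mul_right_inj two_ne_zero (by simp)).1 this

/-- A symmetric law is determined by the integrals of `1 / (1 + y t²)` for small `y > 0`. With
`v = 1 / (1 + y₀ t²)` and `w = 1 - v` one has `1 / (1 + y₀ (1 + r) t²) = v / (1 + r w)`, so the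
expansion in powers of `r` gives the moments of `w`, hence the law of `w` and that of `|t|`. -/
lemma eq_of_integral_eq {μ ν : Measure ℝ} (hμ : IsSymmProb μ) (hν : IsSymmProb ν) {β : ℝ}
    (hβ : 0 < β)
    (h : ∀ y, 0 < y → y < β → ∫ t, 1 / (1 + y * t ^ 2) ∂μ = ∫ t, 1 / (1 + y * t ^ 2) ∂ν) :
    μ = ν := by
  have := hμ.prob
  have := hμ.symm
  have := hν.prob
  have := hν.symm
  set b := β / 2 with hb
  have hb0 : 0 < b := by positivity
  let v : ℝ → ℝ := fun t => 1 / (1 + b * t ^ 2)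
  let w : ℝ → ℝ := fun t => 1 - v t
  have hv : Measurable v := by fun_prop
  have hw : Measurable w := by fun_prop
  have hpos (t : ℝ) : 0 < 1 + b * t ^ 2 := by positivity
  have hv0 (t : ℝ) : 0 < v t := by positivity
  have hv1 (t : ℝ) : v t ≤ 1 := (div_le_one (hpos t)).2 (by nlinarith [sq_nonneg t])
  have hvabs (t : ℝ) : |v t| ≤ 1 := by rw [abs_of_pos (hv0 t)]; exact hv1 t
  have hwabs (t : ℝ) : |w t| ≤ 1 := by
    rw [abs_le]; constructor <;> simp only [w] <;> linarith [hv0 t, hv1 t]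
  have hexp (κ : Measure ℝ) [IsProbabilityMeasure κ] {r : ℝ} (hr : |r| < 1) :
      HasSum (fun k => r ^ k * ∫ t, v t * (-w t) ^ k ∂κ)
        (∫ t, 1 / (1 + b * (1 + r) * t ^ 2) ∂κ) := by
    have := hasSum_integral_div_one_sub (μ := κ) (f := v) (g := fun t => -w t) (A := 1) (B := 1)
      (r := r) hv hw.neg (Eventually.of_forall hvabs)
      (Eventually.of_forall fun t => by rw [abs_neg]; exact hwabs t) zero_le_one (by simpa using hr)
    convert this using 1
    congr 1
    funext t
    have h1 := hpos t
    rw [abs_lt] at hr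
    have h2 : 1 + b * (1 + r) * t ^ 2 ≠ 0 := by
      have : 0 < 1 + r := by linarith
      positivity
    have h3 : 1 - r * -w t = (1 + b * (1 + r) * t ^ 2) / (1 + b * t ^ 2) := by
      simp only [w, v]
      field_simp
      ring
    rw [h3]
    simp only [v]
    field_simp
  have hcoef : (fun k => ∫ t, v t * (-w t) ^ k ∂μ - ∫ t, v t * (-w t) ^ k ∂ν) = 0 := by
    apply coeff_eq_zero_of_eventually_hasSum
    have : ∀ᶠ r : ℝ in 𝓝 0, |r| < 1 := by
      have : Tendsto (fun r : ℝ => |r|) (𝓝 0) (𝓝 |0|) := continuous_abs.tendsto _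
      exact this.eventually_lt_const (by simp)
    filter_upwards [this] with r hr
    have h1 := (hexp μ hr).sub (hexp ν hr)
    rw [h (b * (1 + r)), sub_self] at h1
    · simpa only [mul_sub] using h1
    · rw [abs_lt] at hr
      exact mul_pos hb0 (by linarith)
    · rw [abs_lt] at hr
      nlinarith
  have hcoef' (k : ℕ) : ∫ t, v t * w t ^ k ∂μ = ∫ t, v t * w t ^ k ∂ν := by
    have h1 := congrFun hcoef k
    have h2 (t : ℝ) : v t * (-w t) ^ k = (-1) ^ k * (v t * w t ^ k) := by
      rw [neg_pow]; ring
    simp only [h2, integral_const_mul, Pi.zero_apply, ← mul_sub] at h1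
    have := (mul_eq_zero.1 h1).resolve_left (by positivity)
    linarith
  have hpow (k : ℕ) : ∫ t, w t ^ k ∂μ = ∫ t, w t ^ k ∂ν := by
    induction k with
    | zero => simp
    | succ k ih =>
      have hint (κ : Measure ℝ) [IsProbabilityMeasure κ] (j : ℕ) :
          Integrable (fun t => w t ^ j) κ :=
        Integrable.of_bound (Measurable.aestronglyMeasurable (by fun_prop)) 1
          (Eventually.of_forall fun t => by
            rw [norm_pow]; exact pow_le_one₀ (norm_nonneg _) (hwabs t))
      have hstep (κ : Measure ℝ) [IsProbabilityMeasure κ] :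
          ∫ t, w t ^ (k + 1) ∂κ = ∫ t, w t ^ k ∂κ - ∫ t, v t * w t ^ k ∂κ := by
        have e : ∀ t, v t * w t ^ k = w t ^ k - w t ^ (k + 1) := fun t => by
          simp only [w]; ring
        simp only [e]
        rw [integral_sub (hint κ k) (hint κ (k + 1))]
        ring
      rw [hstep, hstep, ih, hcoef']
  have hmap := map_eq_of_integral_pow_eq hw hwabs hpow
  apply eq_of_map_abs_eq
  have habs : (fun t : ℝ => |t|) = (fun x => √(x / (b * (1 - x)))) ∘ w := by
    funext t
    have h1 := hpos t
    have : w t / (b * (1 - w t)) = t ^ 2 := by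
      simp only [w, v]
      field_simp
      ring
    rw [Function.comp_apply, this, Real.sqrt_sq_eq_abs]
  rw [habs, ← Measure.map_map (by fun_prop) hw, ← Measure.map_map (by fun_prop) hw, hmap]

/-- There is at most one symmetric law with rectangular `R`-transform `z ↦ z`. -/
lemma isRectR_id_unique {lam : ℝ} (hlam0 : 0 ≤ lam) (hlam1 : lam ≤ 1) {μ ν : Measure ℝ}
    (hμ : IsSymmProb μ) (hν : IsSymmProb ν) (h1 : IsRectR lam μ (fun z => z))
    (h2 : IsRectR lam ν (fun z => z)) : μ = ν := by
  obtain ⟨β₁, hβ₁, h1⟩ := momentTransform_neg_of_isRectR hlam0 hlam1 hμ h1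
  obtain ⟨β₂, hβ₂, h2⟩ := momentTransform_neg_of_isRectR hlam0 hlam1 hν h2
  refine eq_of_integral_eq hμ hν (lt_min hβ₁ hβ₂) fun y hy hyβ => ?_
  obtain ⟨M, hM, hM1, hM2⟩ := h1 y hy (hyβ.trans_le (min_le_left _ _))
  obtain ⟨N, hN, hN1, hN2⟩ := h2 y hy (hyβ.trans_le (min_le_right _ _))
  have := root_unique hlam0 hlam1 hy hM1 hN1 hM2 hN2
  linarith

/-! ### Trigonometric integrals -/

lemma one_add_mul_ne_zero {w ζ : ℂ} (hw : ‖w‖ < 1) (hζ : ‖ζ‖ ≤ 1) : 1 + w * ζ ≠ 0 := by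
  intro h
  have h1 : w * ζ = -1 := by linear_combination h
  have h2 : ‖w * ζ‖ < 1 := by
    rw [norm_mul]
    nlinarith [norm_nonneg w, norm_nonneg ζ]
  rw [h1] at h2
  simp at h2

lemma circleMap_mul_circleMap (θ : ℝ) :
    circleMap 0 1 θ * circleMap 0 1 (2 * Real.pi - θ) = 1 := by
  simp only [circleMap, zero_add, Complex.ofReal_one, one_mul]
  rw [← Complex.exp_add, ← Complex.exp_two_pi_mul_I]
  congr 1
  push_cast
  ring

lemma one_add_sq_add_mul_cos (w : ℂ) (θ : ℝ) : 1 + w ^ 2 + 2 * w * (Real.cos θ : ℂ) =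
    (1 + w * circleMap 0 1 θ) * (1 + w * circleMap 0 1 (2 * Real.pi - θ)) := by
  have h4 : circleMap 0 1 θ + circleMap 0 1 (2 * Real.pi - θ) = 2 * (Real.cos θ : ℂ) := by
    simp only [circleMap, zero_add, Complex.ofReal_one, one_mul]
    push_cast
    rw [sub_mul, Complex.exp_sub, Complex.exp_two_pi_mul_I, Complex.two_cos, neg_mul,
      Complex.exp_neg, one_div]
  linear_combination -w * h4 - w ^ 2 * circleMap_mul_circleMap θ

lemma one_add_sq_add_mul_cos_ne_zero {w : ℂ} (hw : ‖w‖ < 1) (θ : ℝ) :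
    1 + w ^ 2 + 2 * w * (Real.cos θ : ℂ) ≠ 0 := by
  rw [one_add_sq_add_mul_cos]
  exact mul_ne_zero (one_add_mul_ne_zero hw (by simp)) (one_add_mul_ne_zero hw (by simp))

/-- The identity `∫ dθ / |1 + w e^{iθ}|² = 2 π / (1 - w²)`, extended to complex `w`: the
exponential terms of `(1 - w²) / (1 + w² + 2 w cos θ) = 1 / (1 + w e^{iθ}) + 1 / (1 + w e^{-iθ}) - 1`
are integrated by the mean value property. -/
lemma integral_poisson {w : ℂ} (hw : ‖w‖ < 1) :
    (1 - w ^ 2) * ∫ θ in (0 : ℝ)..2 * Real.pi, 1 / (1 + w ^ 2 + 2 * w * (Real.cos θ : ℂ)) =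
      2 * Real.pi := by
  have hcont : Continuous fun θ : ℝ => 1 / (1 + w * circleMap 0 1 θ) :=
    continuous_const.div (by fun_prop) fun θ => one_add_mul_ne_zero hw (by simp)
  have hmean : ∫ θ in (0 : ℝ)..2 * Real.pi, 1 / (1 + w * circleMap 0 1 θ) = 2 * Real.pi := by
    have h1 : DiffContOnCl ℂ (fun ζ : ℂ => 1 / (1 + w * ζ)) (Metric.ball 0 |1|) := by
      apply DifferentiableOn.diffContOnCl
      rw [closure_ball _ (by simp)]
      intro ζ hζ
      refine DifferentiableAt.differentiableWithinAt ?_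
      exact DifferentiableAt.div (by fun_prop) (by fun_prop)
        (one_add_mul_ne_zero hw (by simpa using hζ))
    have h2 := h1.circleAverage
    rw [Real.circleAverage_def] at h2
    have hpi : (Real.pi : ℂ) ≠ 0 := by exact_mod_cast Real.pi_ne_zero
    simp at h2
    field_simp at h2
    simpa [mul_comm] using h2
  have hmean' : ∫ θ in (0 : ℝ)..2 * Real.pi, 1 / (1 + w * circleMap 0 1 (2 * Real.pi - θ)) =
      2 * Real.pi := by
    rw [intervalIntegral.integral_comp_sub_left fun θ => 1 / (1 + w * circleMap 0 1 θ)]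
    simpa using hmean
  have hpt (θ : ℝ) : (1 - w ^ 2) * (1 / (1 + w ^ 2 + 2 * w * (Real.cos θ : ℂ))) =
      1 / (1 + w * circleMap 0 1 θ) + 1 / (1 + w * circleMap 0 1 (2 * Real.pi - θ)) - 1 := by
    have h1 : 1 + w * circleMap 0 1 θ ≠ 0 := one_add_mul_ne_zero hw (by simp)
    have h2 : 1 + w * circleMap 0 1 (2 * Real.pi - θ) ≠ 0 := one_add_mul_ne_zero hw (by simp)
    rw [one_add_sq_add_mul_cos]
    field_simp
    linear_combination w ^ 2 * circleMap_mul_circleMap θ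
  rw [← intervalIntegral.integral_const_mul]
  simp_rw [hpt]
  have i1 : IntervalIntegrable (fun θ : ℝ => 1 / (1 + w * circleMap 0 1 θ)) volume 0
      (2 * Real.pi) := hcont.intervalIntegrable _ _
  have i2 : IntervalIntegrable (fun θ : ℝ => 1 / (1 + w * circleMap 0 1 (2 * Real.pi - θ))) volume 0
      (2 * Real.pi) := (hcont.comp (by fun_prop : Continuous fun θ : ℝ => 2 * Real.pi - θ)
        ).intervalIntegrable _ _
  rw [intervalIntegral.integral_sub (i1.add i2) (by simp),
    intervalIntegral.integral_add i1 i2, hmean, hmean', intervalIntegral.integral_const]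
  simp

/-- The reflection `θ ↦ 2 π - θ` maps `[π, 2 π]` to `[0, π]` and preserves the cosine. -/
lemma integral_comp_cos_two_pi {f : ℝ → ℂ} (hf : Continuous fun θ => f (Real.cos θ)) :
    ∫ θ in (0 : ℝ)..2 * Real.pi, f (Real.cos θ) = 2 * ∫ θ in (0 : ℝ)..Real.pi, f (Real.cos θ) := by
  have h : ∫ θ in Real.pi..2 * Real.pi, f (Real.cos θ) =
      ∫ θ in (0 : ℝ)..Real.pi, f (Real.cos θ) := by
    have := intervalIntegral.integral_comp_sub_left (a := 0) (b := Real.pi)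
      (fun θ => f (Real.cos θ)) (2 * Real.pi)
    simp only [Real.cos_two_pi_sub, sub_zero] at this
    rw [this]
    congr 1
    ring
  rw [← intervalIntegral.integral_add_adjacent_intervals (hf.intervalIntegrable 0 Real.pi)
    (hf.intervalIntegrable _ _), h, two_mul]

/-- With `D = 1 + w² + 2 w cos θ` one has `4 w² sin² θ = -D² + 2 (1 + w²) D - (1 - w²)²`, so that
`sin² θ / D` is integrated by means of the integral of `1 / D`. -/
lemma integral_sin_sq_div {w : ℂ} (hw : ‖w‖ < 1) :
    ∫ θ in (0 : ℝ)..Real.pi, (Real.sin θ : ℂ) ^ 2 / (1 + w ^ 2 + 2 * w * (Real.cos θ : ℂ)) =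
      (Real.pi : ℂ) / 2 := by
  have hD := one_add_sq_add_mul_cos_ne_zero hw
  have hcD : Continuous fun θ : ℝ => 1 / (1 + w ^ 2 + 2 * w * (Real.cos θ : ℂ)) :=
    continuous_const.div (by fun_prop) hD
  by_cases hw0 : w = 0
  · have h1 : ∫ θ in (0 : ℝ)..Real.pi, (Real.sin θ : ℂ) ^ 2 =
        ((∫ θ in (0 : ℝ)..Real.pi, Real.sin θ ^ 2 : ℝ) : ℂ) := by
      rw [← intervalIntegral.integral_ofReal]
      push_cast
      rfl
    simp only [hw0, mul_zero, zero_mul, add_zero, ne_eq, OfNat.ofNat_ne_zero, not_false_eq_true,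
      zero_pow, div_one]
    rw [h1, integral_sin_sq]
    simp
  have hpois := integral_poisson hw
  rw [integral_comp_cos_two_pi (f := fun c : ℝ => 1 / (1 + w ^ 2 + 2 * w * (c : ℂ))) hcD] at hpois
  have hcos : ∫ θ in (0 : ℝ)..Real.pi, (Real.cos θ : ℂ) = 0 := by
    rw [intervalIntegral.integral_ofReal, integral_cos]
    simp
  have hpt (θ : ℝ) : 4 * w ^ 2 *
      ((Real.sin θ : ℂ) ^ 2 / (1 + w ^ 2 + 2 * w * (Real.cos θ : ℂ))) =
      ((1 + w ^ 2) - 2 * w * (Real.cos θ : ℂ)) -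
        (1 - w ^ 2) * ((1 - w ^ 2) * (1 / (1 + w ^ 2 + 2 * w * (Real.cos θ : ℂ)))) := by
    have h1 := hD θ
    have h2 : (Real.sin θ : ℂ) ^ 2 = 1 - (Real.cos θ : ℂ) ^ 2 := by
      rw [← Complex.ofReal_pow, Real.sin_sq]
      push_cast
      ring
    rw [h2]
    generalize hq : 1 + w ^ 2 + 2 * w * (Real.cos θ : ℂ) = q at h1 ⊢
    field_simp
    rw [← hq]
    ring
  have key : 4 * w ^ 2 * ∫ θ in (0 : ℝ)..Real.pi,
      (Real.sin θ : ℂ) ^ 2 / (1 + w ^ 2 + 2 * w * (Real.cos θ : ℂ)) =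
      4 * w ^ 2 * ((Real.pi : ℂ) / 2) := by
    rw [← intervalIntegral.integral_const_mul]
    simp_rw [hpt]
    have i1 : IntervalIntegrable (fun θ : ℝ => 2 * w * (Real.cos θ : ℂ)) volume 0 Real.pi :=
      (by fun_prop : Continuous fun θ : ℝ => 2 * w * (Real.cos θ : ℂ)).intervalIntegrable _ _
    have i2 : IntervalIntegrable (fun θ : ℝ => (1 - w ^ 2) * ((1 - w ^ 2) *
        (1 / (1 + w ^ 2 + 2 * w * (Real.cos θ : ℂ))))) volume 0 Real.pi :=
      (continuous_const.mul (continuous_const.mul hcD)).intervalIntegrable _ _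
    have i3 : IntervalIntegrable (fun _ : ℝ => 1 + w ^ 2) volume 0 Real.pi := by simp
    rw [intervalIntegral.integral_sub (i3.sub i1) i2, intervalIntegral.integral_sub i3 i1,
      intervalIntegral.integral_const_mul, intervalIntegral.integral_const_mul,
      intervalIntegral.integral_const_mul, intervalIntegral.integral_const, hcos]
    simp only [sub_zero, Complex.real_smul, mul_zero]
    linear_combination (-(1 - w ^ 2) / 2) * hpois
  exact mul_left_cancel₀ (by simpa using hw0) key

lemma sin_sq_le (s θ : ℝ) : Real.sin θ ^ 2 ≤ 1 + s ^ 2 + 2 * s * Real.cos θ := by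
  nlinarith [sq_nonneg (s + Real.cos θ), Real.sin_sq_add_cos_sq θ]

/-- At `s = 1` the denominator vanishes at `θ = π`, and the integrand is `(1 - cos θ) / 2`. -/
lemma integral_sin_sq_div_real {s : ℝ} (hs0 : 0 ≤ s) (hs1 : s ≤ 1) :
    ∫ θ in Set.Ioo 0 Real.pi, Real.sin θ ^ 2 / (1 + s ^ 2 + 2 * s * Real.cos θ) = Real.pi / 2 := by
  rcases hs1.eq_or_lt with rfl | hs1
  · have : ∫ θ in Set.Ioo 0 Real.pi, Real.sin θ ^ 2 / (1 + 1 ^ 2 + 2 * 1 * Real.cos θ) =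
        ∫ θ in Set.Ioo 0 Real.pi, (1 - Real.cos θ) / 2 := by
      refine setIntegral_congr_fun measurableSet_Ioo fun θ hθ => ?_
      have h1 := Real.sin_pos_of_mem_Ioo hθ
      have h2 : 1 + 1 ^ 2 + 2 * 1 * Real.cos θ ≠ 0 :=
        (lt_of_lt_of_le (by positivity) (sin_sq_le 1 θ)).ne'
      rw [div_eq_div_iff h2 two_ne_zero, Real.sin_sq]
      ring
    rw [this, ← integral_Ioc_eq_integral_Ioo, ← intervalIntegral.integral_of_le Real.pi_pos.le,
      intervalIntegral.integral_div, intervalIntegral.integral_sub (by simp)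
        (Real.continuous_cos.intervalIntegrable _ _), integral_cos]
    simp
  · rw [← integral_Ioc_eq_integral_Ioo, ← intervalIntegral.integral_of_le Real.pi_pos.le]
    have := integral_sin_sq_div (w := (s : ℂ))
      (by rwa [Complex.norm_real, Real.norm_of_nonneg hs0])
    apply Complex.ofReal_injective
    rw [← intervalIntegral.integral_ofReal]
    push_cast at this ⊢
    exact this

/-! ### The rectangular Gaussian law and its image under squaring -/

/-- The law with density `rectGaussianDensity lam`. -/
def rectGaussian (lam : ℝ) : Measure ℝ :=
  volume.withDensity fun x => ENNReal.ofReal (rectGaussianDensity lam x)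

open Classical in
/-- The density of the law of `X²` for a random variable `X` with density
`rectGaussianDensity lam`. -/
def sqGaussianDensity (lam u : ℝ) : ℝ :=
  if u ∈ Set.Icc ((1 - √lam) ^ 2) ((1 + √lam) ^ 2) then
    √(4 * lam - (u - 1 - lam) ^ 2) / (2 * Real.pi * lam * u)
  else 0

lemma measurable_rectGaussianDensity (lam : ℝ) : Measurable (rectGaussianDensity lam) := by
  unfold rectGaussianDensity
  exact Measurable.ite (measurableSet_Icc.preimage (by fun_prop : Measurable fun x : ℝ => x ^ 2))
    (by fun_prop) measurable_const

lemma measurable_sqGaussianDensity (lam : ℝ) : Measurable (sqGaussianDensity lam) := by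
  unfold sqGaussianDensity
  exact Measurable.ite measurableSet_Icc (by fun_prop) measurable_const

lemma measurable_marchenkoPasturDensity (c : ℝ) : Measurable (marchenkoPasturDensity c) := by
  unfold marchenkoPasturDensity
  exact Measurable.ite measurableSet_Icc (by fun_prop) measurable_const

lemma rectGaussianDensity_neg (lam x : ℝ) :
    rectGaussianDensity lam (-x) = rectGaussianDensity lam x := by
  simp [rectGaussianDensity]

/-- The density vanishes at the endpoints of its interval too. -/
lemma sqGaussianDensity_eq_zero {lam u : ℝ} (hlam : 0 ≤ lam)
    (hu : u ∉ Set.Ioo ((1 - √lam) ^ 2) ((1 + √lam) ^ 2)) : sqGaussianDensity lam u = 0 := by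
  rw [sqGaussianDensity]
  split_ifs with h
  · have hs := Real.sq_sqrt hlam
    have hz : 4 * lam - (u - 1 - lam) ^ 2 = 0 := by
      have e : 4 * lam - (u - 1 - lam) ^ 2 = 4 * √lam ^ 2 - (u - 1 - √lam ^ 2) ^ 2 := by rw [hs]
      rw [e]
      rcases h.1.eq_or_lt with h1 | h1
      · rw [← h1]
        ring
      · rcases h.2.eq_or_lt with h2 | h2
        · rw [h2]
          ring
        · exact absurd ⟨h1, h2⟩ hu
    rw [hz]
    simp
  · rfl

lemma lintegral_eq_setLIntegral {f : ℝ → ENNReal} {s : Set ℝ} (hs : MeasurableSet s)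
    (hf : ∀ x ∉ s, f x = 0) : ∫⁻ x, f x = ∫⁻ x in s, f x := by
  rw [← lintegral_indicator hs, Set.indicator_eq_self.2]
  intro x hx
  by_contra h
  exact hx (hf x h)

lemma lintegral_of_even {f : ℝ → ENNReal} (hf : ∀ x, f (-x) = f x) :
    ∫⁻ x, f x = 2 * ∫⁻ x in Set.Ioi 0, f x := by
  have h1 : ∫⁻ x in Set.Iic 0, f x = ∫⁻ x in Set.Ioi 0, f x := by
    rw [setLIntegral_congr Iio_ae_eq_Iic.symm]
    have := (Measure.measurePreserving_neg (volume : Measure ℝ)).setLIntegral_comp_preimage_emb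
      (MeasurableEquiv.neg ℝ).measurableEmbedding f (Set.Ioi 0)
    rw [← this]
    simp [hf]
  rw [← lintegral_add_compl f (measurableSet_Ioi (a := (0 : ℝ))), Set.compl_Ioi, h1, two_mul]

lemma lintegral_map_withDensity {μ : Measure ℝ} {ρ f : ℝ → ENNReal} {φ : ℝ → ℝ}
    (hρ : Measurable ρ) (hf : Measurable f) (hφ : Measurable φ) :
    ∫⁻ y, f y ∂((μ.withDensity ρ).map φ) = ∫⁻ x, ρ x * f (φ x) ∂μ := by
  rw [lintegral_map hf hφ]
  exact lintegral_withDensity_eq_lintegral_mul _ hρ (hf.comp hφ)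

/-- Substitution `u = x²`. -/
lemma map_sq_rectGaussian {lam : ℝ} (hlam : 0 < lam) : (rectGaussian lam).map (fun x => x ^ 2) =
    volume.withDensity fun u => ENNReal.ofReal (sqGaussianDensity lam u) := by
  refine Measure.ext_of_lintegral _ fun f hf => ?_
  rw [rectGaussian, lintegral_map_withDensity
      (measurable_rectGaussianDensity lam).ennreal_ofReal hf (by fun_prop),
    lintegral_withDensity_eq_lintegral_mul _ (measurable_sqGaussianDensity lam).ennreal_ofReal hf,
    lintegral_of_even (by simp [rectGaussianDensity_neg]),
    lintegral_eq_setLIntegral (measurableSet_Ioi (a := (0 : ℝ)))]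
  · have himg : (fun x : ℝ => x ^ 2) '' Set.Ioi 0 = Set.Ioi 0 := by
      ext u
      constructor
      · rintro ⟨x, hx, rfl⟩
        have : 0 < x := hx
        exact pow_pos this 2
      · intro hu
        exact ⟨√u, Real.sqrt_pos.2 hu, Real.sq_sqrt (le_of_lt hu)⟩
    have hinj : Set.InjOn (fun x : ℝ => x ^ 2) (Set.Ioi 0) := fun x hx y hy h =>
      (pow_left_inj₀ (le_of_lt hx) (le_of_lt hy) two_ne_zero).1 h
    conv_rhs => rw [← himg]
    rw [lintegral_image_eq_lintegral_abs_deriv_mul measurableSet_Ioi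
      (f := fun x : ℝ => x ^ 2) (f' := fun x => 2 * x)
      (fun x _ => by simpa using (hasDerivAt_pow 2 x).hasDerivWithinAt) hinj,
      ← lintegral_const_mul' _ _ (by simp)]
    refine setLIntegral_congr_fun measurableSet_Ioi fun x hx => ?_
    have hx : 0 < x := hx
    have h1 : |2 * x| * sqGaussianDensity lam (x ^ 2) = 2 * rectGaussianDensity lam x := by
      rw [abs_of_pos (by positivity), sqGaussianDensity, rectGaussianDensity, abs_of_pos hx]
      split_ifs
      · field_simp
      · simp
    simp only [Pi.mul_apply]
    rw [← mul_assoc, ← mul_assoc, ← ENNReal.ofReal_mul (abs_nonneg _), h1,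
      ENNReal.ofReal_mul (by norm_num)]
    simp
  · intro x hx
    have : sqGaussianDensity lam x = 0 := sqGaussianDensity_eq_zero hlam.le fun h =>
      hx (lt_of_le_of_lt (sq_nonneg _) h.1)
    simp [this]

/-- Substitution `u = lam t`. As `1 / lam ≥ 1`, the Marchenko-Pastur law has no atom. -/
lemma map_mul_marchenkoPastur {lam : ℝ} (hlam0 : 0 < lam) (hlam1 : lam ≤ 1) :
    (marchenkoPastur (1 / lam)).map (fun t => lam * t) =
      volume.withDensity fun u => ENNReal.ofReal (sqGaussianDensity lam u) := by
  have hatom : ENNReal.ofReal (1 - 1 / lam) = 0 := by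
    rw [ENNReal.ofReal_eq_zero, sub_nonpos, le_div_iff₀ hlam0]
    linarith
  rw [marchenkoPastur, hatom, zero_smul, zero_add]
  refine Measure.ext_of_lintegral _ fun f hf => ?_
  rw [lintegral_map_withDensity
      (measurable_marchenkoPasturDensity _).ennreal_ofReal hf (by fun_prop),
    lintegral_withDensity_eq_lintegral_mul _ (measurable_sqGaussianDensity lam).ennreal_ofReal hf]
  have himg : (fun x : ℝ => lam * x) '' Set.univ = Set.univ := by
    rw [Set.image_univ]
    exact (mul_left_surjective₀ hlam0.ne').range_eq
  conv_rhs => rw [← setLIntegral_univ, ← himg]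
  rw [lintegral_image_eq_lintegral_abs_deriv_mul MeasurableSet.univ
    (f := fun x : ℝ => lam * x) (f' := fun x => lam)
    (fun x _ => by simpa using (hasDerivAt_id x).const_mul lam)
    (mul_right_injective₀ hlam0.ne').injOn, setLIntegral_univ]
  refine lintegral_congr fun t => ?_
  have hs : 0 < √lam := Real.sqrt_pos.2 hlam0
  have hs2 := Real.sq_sqrt hlam0.le
  have hinv : √(1 / lam) = 1 / √lam := by rw [Real.sqrt_div zero_le_one, Real.sqrt_one]
  have h1 : |lam| * sqGaussianDensity lam (lam * t) = marchenkoPasturDensity (1 / lam) t := by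
    have e1 : (1 - √lam) ^ 2 = lam * (1 - 1 / √lam) ^ 2 := by
      nth_rewrite 2 [← hs2]
      field_simp
      ring
    have e2 : (1 + √lam) ^ 2 = lam * (1 + 1 / √lam) ^ 2 := by
      nth_rewrite 2 [← hs2]
      field_simp
      ring
    have e3 : √(4 * lam - (lam * t - 1 - lam) ^ 2) =
        lam * √(4 * (1 / lam) - (t - 1 - 1 / lam) ^ 2) := by
      rw [← Real.sqrt_sq_eq_abs lam |>.trans (abs_of_pos hlam0), ← Real.sqrt_mul (sq_nonneg lam),
        Real.sqrt_sq hlam0.le]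
      congr 1
      field_simp
      ring
    rw [abs_of_pos hlam0, sqGaussianDensity, marchenkoPasturDensity, hinv]
    have hiff : lam * t ∈ Set.Icc ((1 - √lam) ^ 2) ((1 + √lam) ^ 2) ↔
        t ∈ Set.Icc ((1 - 1 / √lam) ^ 2) ((1 + 1 / √lam) ^ 2) := by
      rw [e1, e2, Set.mem_Icc, Set.mem_Icc, mul_le_mul_iff_right₀ hlam0, mul_le_mul_iff_right₀ hlam0]
    simp only [hiff]
    split_ifs
    · rw [e3]
      by_cases ht : t = 0
      · simp [ht]
      · field_simp
    · simp
  simp only [Pi.mul_apply]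
  rw [← mul_assoc, ← ENNReal.ofReal_mul (abs_nonneg _), h1]

/-- Substitution `u = 1 + lam + 2 √lam cos θ`. -/
lemma withDensity_sqGaussianDensity_eq_map {lam : ℝ} (hlam : 0 < lam) :
    (volume.withDensity fun u => ENNReal.ofReal (sqGaussianDensity lam u)) =
      ((volume.restrict (Set.Ioo 0 Real.pi)).withDensity fun θ => ENNReal.ofReal
        (2 / Real.pi * (Real.sin θ ^ 2 / (1 + √lam ^ 2 + 2 * √lam * Real.cos θ)))).map
        (fun θ => 1 + √lam ^ 2 + 2 * √lam * Real.cos θ) := by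
  have hs : 0 < √lam := Real.sqrt_pos.2 hlam
  have hs2 := Real.sq_sqrt hlam.le
  set s := √lam with hsdef
  refine Measure.ext_of_lintegral _ fun f hf => ?_
  have hm : Measurable fun θ : ℝ => 1 + s ^ 2 + 2 * s * Real.cos θ := by fun_prop
  rw [lintegral_map_withDensity (by fun_prop) hf hm,
    lintegral_withDensity_eq_lintegral_mul _ (measurable_sqGaussianDensity lam).ennreal_ofReal hf,
    lintegral_eq_setLIntegral (measurableSet_Ioo (a := (1 - s) ^ 2) (b := (1 + s) ^ 2))]
  · have himg : (fun θ : ℝ => 1 + s ^ 2 + 2 * s * Real.cos θ) '' Set.Ioo 0 Real.pi =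
        Set.Ioo ((1 - s) ^ 2) ((1 + s) ^ 2) := by
      ext u
      constructor
      · rintro ⟨θ, hθ, rfl⟩
        have h1 := Real.sin_pos_of_mem_Ioo hθ
        have h2 := Real.sin_sq_add_cos_sq θ
        have h3 : Real.cos θ ^ 2 < 1 := by nlinarith
        obtain ⟨h4, h5⟩ := abs_lt.1 ((sq_lt_one_iff_abs_lt_one _).1 h3)
        constructor <;> beta_reduce <;> nlinarith
      · rintro ⟨h1, h2⟩
        have h3 : -1 < (u - 1 - s ^ 2) / (2 * s) := by
          rw [lt_div_iff₀ (by positivity)]; nlinarith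
        have h4 : (u - 1 - s ^ 2) / (2 * s) < 1 := by
          rw [div_lt_iff₀ (by positivity)]; nlinarith
        refine ⟨Real.arccos ((u - 1 - s ^ 2) / (2 * s)), ⟨Real.arccos_pos.2 h4, ?_⟩, ?_⟩
        · refine lt_of_le_of_ne (Real.arccos_le_pi _) fun h => ?_
          rw [Real.arccos_eq_pi] at h
          linarith
        · beta_reduce
          rw [Real.cos_arccos h3.le h4.le]
          field_simp
          ring
    have hinj : Set.InjOn (fun θ : ℝ => 1 + s ^ 2 + 2 * s * Real.cos θ) (Set.Ioo 0 Real.pi) := by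
      intro x hx y hy h
      have h1 : 2 * s * Real.cos x = 2 * s * Real.cos y := by simpa using h
      exact Real.injOn_cos (Set.Ioo_subset_Icc_self hx) (Set.Ioo_subset_Icc_self hy)
        (mul_left_cancel₀ (by positivity) h1)
    rw [← himg, lintegral_image_eq_lintegral_abs_deriv_mul measurableSet_Ioo
      (f := fun θ : ℝ => 1 + s ^ 2 + 2 * s * Real.cos θ) (f' := fun θ => 2 * s * -Real.sin θ)
      (fun x _ => (((Real.hasDerivAt_cos x).const_mul (2 * s)).const_add _).hasDerivWithinAt) hinj]
    refine setLIntegral_congr_fun measurableSet_Ioo fun θ hθ => ?_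
    have hsin := Real.sin_pos_of_mem_Ioo hθ
    have hu : 1 + s ^ 2 + 2 * s * Real.cos θ ∈ Set.Ioo ((1 - s) ^ 2) ((1 + s) ^ 2) :=
      himg ▸ Set.mem_image_of_mem _ hθ
    have h1 : |2 * s * -Real.sin θ| * sqGaussianDensity lam (1 + s ^ 2 + 2 * s * Real.cos θ) =
        2 / Real.pi * (Real.sin θ ^ 2 / (1 + s ^ 2 + 2 * s * Real.cos θ)) := by
      have e1 : 4 * lam - (1 + s ^ 2 + 2 * s * Real.cos θ - 1 - lam) ^ 2 =
          (2 * s * Real.sin θ) ^ 2 := by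
        rw [← hs2, mul_pow, mul_pow, Real.sin_sq]
        ring
      have hu0 : 0 < 1 + s ^ 2 + 2 * s * Real.cos θ := lt_of_le_of_lt (sq_nonneg _) hu.1
      rw [sqGaussianDensity, ← hsdef, if_pos (Set.Ioo_subset_Icc_self hu), e1,
        Real.sqrt_sq (by positivity), mul_neg, abs_neg, abs_of_pos (by positivity), ← hs2]
      generalize 1 + s ^ 2 + 2 * s * Real.cos θ = q at hu0 ⊢
      field_simp
    simp only [Pi.mul_apply]
    rw [← mul_assoc, ← ENNReal.ofReal_mul (abs_nonneg _), h1]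
  · intro x hx
    have : sqGaussianDensity lam x = 0 := sqGaussianDensity_eq_zero hlam.le hx
    simp [this]

lemma map_sq_rectGaussian_eq_map {lam : ℝ} (hlam : 0 < lam) :
    (rectGaussian lam).map (fun x => x ^ 2) =
      ((volume.restrict (Set.Ioo 0 Real.pi)).withDensity fun θ => ENNReal.ofReal
        (2 / Real.pi * (Real.sin θ ^ 2 / (1 + √lam ^ 2 + 2 * √lam * Real.cos θ)))).map
        (fun θ => 1 + √lam ^ 2 + 2 * √lam * Real.cos θ) :=
  (map_sq_rectGaussian hlam).trans (withDensity_sqGaussianDensity_eq_map hlam)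

lemma sin_sq_div_nonneg (s θ : ℝ) :
    0 ≤ Real.sin θ ^ 2 / (1 + s ^ 2 + 2 * s * Real.cos θ) :=
  div_nonneg (sq_nonneg _) ((sq_nonneg _).trans (sin_sq_le s θ))

lemma integrable_sin_sq_div (s : ℝ) :
    Integrable (fun θ => Real.sin θ ^ 2 / (1 + s ^ 2 + 2 * s * Real.cos θ))
      (volume.restrict (Set.Ioo 0 Real.pi)) := by
  refine Integrable.of_bound (C := 1) (Measurable.aestronglyMeasurable (by fun_prop))
    (Eventually.of_forall fun θ => ?_)
  rw [Real.norm_of_nonneg (sin_sq_div_nonneg s θ)]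
  exact div_le_one_of_le₀ (sin_sq_le s θ) ((sq_nonneg _).trans (sin_sq_le s θ))

lemma integral_rectGaussian_sq {lam : ℝ} (hlam : 0 < lam) {f : ℝ → ℂ} (hf : Measurable f) :
    ∫ x, f (x ^ 2) ∂(rectGaussian lam) = ∫ θ in Set.Ioo 0 Real.pi,
      (2 / Real.pi * (Real.sin θ ^ 2 / (1 + √lam ^ 2 + 2 * √lam * Real.cos θ)) : ℝ) *
        f (1 + √lam ^ 2 + 2 * √lam * Real.cos θ) := by
  have h1 : ∫ x, f (x ^ 2) ∂(rectGaussian lam) =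
      ∫ u, f u ∂((rectGaussian lam).map (fun x => x ^ 2)) :=
    (integral_map (by fun_prop) hf.aestronglyMeasurable).symm
  rw [h1, map_sq_rectGaussian_eq_map hlam, integral_map (by fun_prop) hf.aestronglyMeasurable,
    integral_withDensity_eq_integral_toReal_smul (by fun_prop)
      (Eventually.of_forall fun θ => ENNReal.ofReal_lt_top)]
  congr 1
  funext θ
  rw [ENNReal.toReal_ofReal (mul_nonneg (by positivity) (sin_sq_div_nonneg _ θ)),
    Complex.real_smul]

lemma isProbabilityMeasure_rectGaussian {lam : ℝ} (hlam0 : 0 < lam) (hlam1 : lam ≤ 1) :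
    IsProbabilityMeasure (rectGaussian lam) := by
  constructor
  have h1 : rectGaussian lam Set.univ = (rectGaussian lam).map (fun x => x ^ 2) Set.univ := by
    rw [Measure.map_apply (by fun_prop) MeasurableSet.univ, Set.preimage_univ]
  rw [h1, map_sq_rectGaussian_eq_map hlam0, Measure.map_apply (by fun_prop) MeasurableSet.univ,
    Set.preimage_univ, withDensity_apply _ MeasurableSet.univ, Measure.restrict_univ,
    ← ofReal_integral_eq_lintegral_ofReal ((integrable_sin_sq_div _).const_mul _)
      (Eventually.of_forall fun θ => mul_nonneg (by positivity) (sin_sq_div_nonneg _ θ)),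
    integral_const_mul, integral_sin_sq_div_real (Real.sqrt_nonneg _) (Real.sqrt_le_one.2 hlam1)]
  have := Real.pi_ne_zero
  field_simp
  simp

lemma isSymmProb_rectGaussian {lam : ℝ} (hlam0 : 0 < lam) (hlam1 : lam ≤ 1) :
    IsSymmProb (rectGaussian lam) := by
  refine ⟨isProbabilityMeasure_rectGaussian hlam0 hlam1, ⟨?_⟩⟩
  refine Measure.ext_of_lintegral _ fun f hf => ?_
  rw [Measure.neg, rectGaussian, lintegral_map_withDensity
      (measurable_rectGaussianDensity lam).ennreal_ofReal hf measurable_neg,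
    lintegral_withDensity_eq_lintegral_mul _ (measurable_rectGaussianDensity lam).ennreal_ofReal hf,
    ← lintegral_neg_eq_self]
  simp [rectGaussianDensity_neg]

/-- The support of the density, up to the boundary. -/
lemma rectGaussianDensity_eq_zero {lam x : ℝ} (hlam1 : lam ≤ 1)
    (hx : x ∉ Set.Icc (-1 - √lam) (-1 + √lam) ∪ Set.Icc (1 - √lam) (1 + √lam)) :
    rectGaussianDensity lam x = 0 := by
  have hs1 : √lam ≤ 1 := Real.sqrt_le_one.2 hlam1
  have hs0 := Real.sqrt_nonneg lam
  rw [rectGaussianDensity, if_neg]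
  rintro ⟨h1, h2⟩
  rw [← abs_of_nonneg (sub_nonneg.2 hs1), sq_le_sq, abs_abs, abs_of_nonneg (sub_nonneg.2 hs1)] at h1
  rw [sq_le_sq, abs_of_nonneg (by positivity : 0 ≤ 1 + √lam)] at h2
  apply hx
  rcases abs_cases x with ⟨h, -⟩ | ⟨h, -⟩
  · right; constructor <;> linarith
  · left; constructor <;> linarith

lemma rectGaussianDensity_pos {lam x : ℝ} (hlam0 : 0 < lam) (hlam1 : lam ≤ 1)
    (hx : x ∈ Set.Ioo (-1 - √lam) (-1 + √lam) ∪ Set.Ioo (1 - √lam) (1 + √lam)) :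
    0 < rectGaussianDensity lam x := by
  wlog hpos : x ∈ Set.Ioo (1 - √lam) (1 + √lam) generalizing x with H
  · rw [← rectGaussianDensity_neg]
    have : -x ∈ Set.Ioo (1 - √lam) (1 + √lam) := by
      rcases hx with hx | hx
      · exact ⟨by linarith [hx.2], by linarith [hx.1]⟩
      · exact absurd hx hpos
    exact H (Or.inr this) this
  have hs1 : √lam ≤ 1 := Real.sqrt_le_one.2 hlam1
  have hs0 := Real.sqrt_pos.2 hlam0
  have hs2 := Real.sq_sqrt hlam0.le
  obtain ⟨h1, h2⟩ := hpos
  have hx0 : 0 < x := by linarith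
  have h3 : (1 - √lam) ^ 2 < x ^ 2 := by gcongr
  have h4 : x ^ 2 < (1 + √lam) ^ 2 := by gcongr
  rw [rectGaussianDensity, if_pos ⟨h3.le, h4.le⟩]
  have : 0 < 4 * lam - (x ^ 2 - 1 - lam) ^ 2 := by
    have e : 4 * lam - (x ^ 2 - 1 - lam) ^ 2 = 4 * √lam ^ 2 - (x ^ 2 - 1 - √lam ^ 2) ^ 2 := by
      rw [hs2]
    rw [e]
    nlinarith
  have := Real.sqrt_pos.2 this
  positivity

lemma ae_rectGaussian_mem {lam : ℝ} (hlam1 : lam ≤ 1) : ∀ᵐ x ∂(rectGaussian lam),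
    x ∈ Set.Icc (-1 - √lam) (-1 + √lam) ∪ Set.Icc (1 - √lam) (1 + √lam) := by
  rw [rectGaussian, ae_withDensity_iff (measurable_rectGaussianDensity lam).ennreal_ofReal]
  refine Eventually.of_forall fun x hx => ?_
  by_contra h
  exact hx (by rw [rectGaussianDensity_eq_zero hlam1 h, ENNReal.ofReal_zero])

lemma ae_rectGaussian_abs_le {lam : ℝ} (hlam1 : lam ≤ 1) :
    ∀ᵐ x ∂(rectGaussian lam), |x| ≤ 2 := by
  have hs1 : √lam ≤ 1 := Real.sqrt_le_one.2 hlam1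
  filter_upwards [ae_rectGaussian_mem hlam1] with x hx
  rw [abs_le]
  rcases hx with ⟨h1, h2⟩ | ⟨h1, h2⟩ <;> constructor <;> linarith

lemma support_rectGaussian {lam : ℝ} (hlam0 : 0 < lam) (hlam1 : lam ≤ 1) :
    (rectGaussian lam).support =
      Set.Icc (-1 - √lam) (-1 + √lam) ∪ Set.Icc (1 - √lam) (1 + √lam) := by
  have hs0 := Real.sqrt_pos.2 hlam0
  apply Set.Subset.antisymm
  · exact Measure.support_subset_of_isClosed (isClosed_Icc.union isClosed_Icc)
      (ae_rectGaussian_mem hlam1)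
  · rw [← closure_Ioo (by linarith : -1 - √lam ≠ -1 + √lam),
      ← closure_Ioo (by linarith : 1 - √lam ≠ 1 + √lam), ← closure_union]
    refine closure_minimal (fun x hx => ?_) Measure.isClosed_support
    rw [Measure.mem_support_iff_forall]
    intro U hU
    set O := Set.Ioo (-1 - √lam) (-1 + √lam) ∪ Set.Ioo (1 - √lam) (1 + √lam) with hO
    have hOopen : IsOpen O := isOpen_Ioo.union isOpen_Ioo
    obtain ⟨V, hVU, hV, hxV⟩ := mem_nhds_iff.1 hU
    have hpos : 0 < (volume : Measure ℝ) (V ∩ O) :=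
      (hV.inter hOopen).measure_pos _ ⟨x, hxV, hx⟩
    refine lt_of_lt_of_le ?_ (measure_mono (Set.inter_subset_left.trans hVU : V ∩ O ⊆ U))
    rw [rectGaussian, withDensity_apply _ (hV.inter hOopen).measurableSet, pos_iff_ne_zero]
    intro h
    rw [lintegral_eq_zero_iff (measurable_rectGaussianDensity lam).ennreal_ofReal,
      Filter.EventuallyEq, ae_restrict_iff' (hV.inter hOopen).measurableSet] at h
    apply hpos.ne'
    refine measure_mono_null (fun y hy => ?_) h
    intro h0
    have := rectGaussianDensity_pos hlam0 hlam1 hy.2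
    have h1 := h0 hy
    simp at h1
    linarith

/-- For `z = ratInv lam 1 w` and `u = 1 + lam + 2 √lam cos θ`, the number `1 - z u` is a multiple of
`1 + W² + 2 W cos θ` with `W = -√lam w`, which reduces the transform to `integral_sin_sq_div`. -/
lemma momentTransform_rectGaussian {lam : ℝ} (hlam0 : 0 < lam) (hlam1 : lam ≤ 1) :
    ∀ᶠ w in 𝓝 (0 : ℂ), momentTransform (rectGaussian lam) (ratInv lam 1 w) = 1 + w := by
  have hsmall : ∀ᶠ w in 𝓝 (0 : ℂ), ‖-(√lam : ℂ) * w‖ < 1 := by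
    have : Tendsto (fun w : ℂ => ‖-(√lam : ℂ) * w‖) (𝓝 0) (𝓝 ‖-(√lam : ℂ) * 0‖) :=
      (by fun_prop : Continuous fun w : ℂ => ‖-(√lam : ℂ) * w‖).tendsto _
    exact this.eventually_lt_const (by simp)
  filter_upwards [hsmall, eventually_denom_ne_zero lam 1] with w hw hden
  have hs2 := Real.sq_sqrt hlam0.le
  set s := √lam with hs
  rw [Complex.ofReal_one, one_mul] at hden
  have h1 : momentTransform (rectGaussian lam) (ratInv lam 1 w) =
      ∫ x : ℝ, (fun u : ℝ => 1 / (1 - ratInv lam 1 w * (u : ℂ))) (x ^ 2) ∂(rectGaussian lam) := by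
    rw [momentTransform]
    congr 1
    funext x
    push_cast
    rfl
  rw [h1, integral_rectGaussian_sq hlam0
    (f := fun u : ℝ => 1 / (1 - ratInv lam 1 w * (u : ℂ))) (by fun_prop)]
  have hD := one_add_sq_add_mul_cos_ne_zero hw
  have hpt : ∀ θ ∈ Set.Ioo 0 Real.pi,
      ((2 / Real.pi * (Real.sin θ ^ 2 / (1 + s ^ 2 + 2 * s * Real.cos θ)) : ℝ) : ℂ) *
        (1 / (1 - ratInv lam 1 w * ((1 + s ^ 2 + 2 * s * Real.cos θ : ℝ) : ℂ))) =
      ((2 / Real.pi * (Real.sin θ ^ 2 / (1 + s ^ 2 + 2 * s * Real.cos θ)) : ℝ) : ℂ) +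
        2 / Real.pi * w * ((Real.sin θ : ℂ) ^ 2 /
          (1 + (-(s : ℂ) * w) ^ 2 + 2 * (-(s : ℂ) * w) * (Real.cos θ : ℂ))) := by
    intro θ hθ
    have hu : 0 < 1 + s ^ 2 + 2 * s * Real.cos θ :=
      lt_of_lt_of_le (pow_pos (Real.sin_pos_of_mem_Ioo hθ) 2) (sin_sq_le s θ)
    have hq := hD θ
    have hpi : (Real.pi : ℂ) ≠ 0 := by exact_mod_cast Real.pi_ne_zero
    generalize hc : Real.cos θ = c at hu hq ⊢
    generalize hv : Real.sin θ = v
    have hu' : (1 + (s : ℂ) ^ 2 + 2 * s * c) ≠ 0 := by exact_mod_cast hu.ne'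
    have hls : (lam : ℂ) = (s : ℂ) ^ 2 := by rw [← hs2]; push_cast; rfl
    have e : 1 - ratInv lam 1 w * ((1 + s ^ 2 + 2 * s * c : ℝ) : ℂ) =
        (1 + (-(s : ℂ) * w) ^ 2 + 2 * (-(s : ℂ) * w) * (c : ℂ)) / ((lam * w + 1) * (w + 1)) := by
      rw [ratInv, eq_div_iff hden]
      push_cast
      rw [one_mul, sub_mul, div_mul_eq_mul_div, div_mul_cancel₀ _ hden, hls]
      ring
    rw [e, one_div_div]
    push_cast
    have e2 : (lam * w + 1) * (w + 1) = (1 + (-(s : ℂ) * w) ^ 2 + 2 * (-(s : ℂ) * w) * (c : ℂ)) +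
        w * (1 + (s : ℂ) ^ 2 + 2 * s * c) := by
      rw [hls]
      ring
    rw [e2]
    generalize (1 + (-(s : ℂ) * w) ^ 2 + 2 * (-(s : ℂ) * w) * (c : ℂ)) = q at hq ⊢
    generalize (1 + (s : ℂ) ^ 2 + 2 * s * c) = u at hu' ⊢
    field_simp
  rw [setIntegral_congr_fun measurableSet_Ioo hpt]
  have i1 : Integrable (fun θ => ((2 / Real.pi *
      (Real.sin θ ^ 2 / (1 + s ^ 2 + 2 * s * Real.cos θ)) : ℝ) : ℂ))
      (volume.restrict (Set.Ioo 0 Real.pi)) := ((integrable_sin_sq_div s).const_mul _).ofReal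
  have i2 : Integrable (fun θ : ℝ => 2 / Real.pi * w * ((Real.sin θ : ℂ) ^ 2 /
      (1 + (-(s : ℂ) * w) ^ 2 + 2 * (-(s : ℂ) * w) * (Real.cos θ : ℂ))))
      (volume.restrict (Set.Ioo 0 Real.pi)) := by
    have hc : Continuous (fun θ : ℝ => 2 / Real.pi * w * ((Real.sin θ : ℂ) ^ 2 /
      (1 + (-(s : ℂ) * w) ^ 2 + 2 * (-(s : ℂ) * w) * (Real.cos θ : ℂ)))) :=
      continuous_const.mul (Continuous.div (by fun_prop) (by fun_prop) hD)
    exact (hc.integrableOn_Icc (a := 0) (b := Real.pi)).mono_set Set.Ioo_subset_Icc_self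
  rw [integral_add i1 i2, integral_const_mul, integral_complex_ofReal, integral_const_mul,
    integral_sin_sq_div_real (Real.sqrt_nonneg _) (Real.sqrt_le_one.2 hlam1),
    ← integral_Ioc_eq_integral_Ioo, ← intervalIntegral.integral_of_le Real.pi_pos.le,
    integral_sin_sq_div hw]
  have hpi : (Real.pi : ℂ) ≠ 0 := by exact_mod_cast Real.pi_ne_zero
  push_cast
  field_simp

/-! ### The case of ratio zero -/

lemma isSymmProb_bernoulli :
    IsSymmProb ((2⁻¹ : ENNReal) • (Measure.dirac (1 : ℝ) + Measure.dirac (-1))) := by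
  refine ⟨⟨?_⟩, ⟨?_⟩⟩
  · simp [ENNReal.inv_two_add_inv_two]
  · rw [Measure.neg, Measure.map_smul, Measure.map_add _ _ measurable_neg,
      Measure.map_dirac' measurable_neg, Measure.map_dirac' measurable_neg, neg_neg, add_comm]

lemma ae_bernoulli_abs_le :
    ∀ᵐ x ∂((2⁻¹ : ENNReal) • (Measure.dirac (1 : ℝ) + Measure.dirac (-1))), |x| ≤ 2 := by
  refine Measure.ae_smul_measure ?_ _
  rw [ae_add_measure_iff, ae_dirac_eq, ae_dirac_eq]
  simp

lemma momentTransform_bernoulli : ∀ᶠ w in 𝓝 (0 : ℂ),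
    momentTransform ((2⁻¹ : ENNReal) • (Measure.dirac (1 : ℝ) + Measure.dirac (-1)))
      (ratInv 0 1 w) = 1 + w := by
  filter_upwards [eventually_denom_ne_zero 0 1] with w hw
  rw [momentTransform, integral_smul_measure, integral_add_measure (integrable_dirac (by simp)) (integrable_dirac (by simp)),
    integral_dirac, integral_dirac]
  simp [ratInv] at hw ⊢
  have : 1 - w / (w + 1) = 1 / (w + 1) := by field_simp; ring
  rw [this]
  field_simp
  ring

/-! ### Moments -/

lemma integrable_pow_of_ae_abs_le {μ : Measure ℝ} [IsFiniteMeasure μ] {R : ℝ}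
    (hR : ∀ᵐ x ∂μ, |x| ≤ R) (k : ℕ) : Integrable (fun x : ℝ => x ^ k) μ := by
  refine Integrable.of_bound (C := R ^ k) (Measurable.aestronglyMeasurable (by fun_prop)) ?_
  filter_upwards [hR] with x hx
  rw [norm_pow, Real.norm_eq_abs]
  gcongr

lemma momentTransform_ofReal (μ : Measure ℝ) (z : ℝ) :
    momentTransform μ (z : ℂ) = ((∫ x, 1 / (1 - z * x ^ 2) ∂μ : ℝ) : ℂ) := by
  rw [momentTransform, ← integral_complex_ofReal]
  push_cast
  rfl

/-- The inversion `m_μ(F(w)) = 1 + w` amounts to the equation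
`m_μ(z) - 1 = z (lam m_μ(z) + 1 - lam) m_μ(z)` near zero, which is a recursion for the moments. -/
lemma moment_recursion {lam R : ℝ} {μ : Measure ℝ} [IsProbabilityMeasure μ]
    (hR : ∀ᵐ x ∂μ, |x| ≤ R)
    (hm : ∀ᶠ w in 𝓝 (0 : ℂ), momentTransform μ (ratInv lam 1 w) = 1 + w) (n : ℕ) :
    ∫ x, x ^ (2 * (n + 1)) ∂μ = lam * ∑ k ∈ Finset.range (n + 1),
      (∫ x, x ^ (2 * k) ∂μ) * (∫ x, x ^ (2 * (n - k)) ∂μ) + (1 - lam) * ∫ x, x ^ (2 * n) ∂μ := by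
  have hquad : ∀ᶠ z in 𝓝 (0 : ℂ), momentTransform μ z - 1 =
      z * (lam * momentTransform μ z ^ 2 + (1 - lam) * momentTransform μ z) := by
    rw [← map_ratInv_nhds lam 1, eventually_map]
    filter_upwards [hm, eventually_denom_ne_zero lam 1] with w h1 h2
    rw [h1, ratInv, div_mul_eq_mul_div, eq_div_iff h2]
    push_cast
    ring
  have hquad' : ∀ᶠ z in 𝓝 (0 : ℝ), (∫ x, 1 / (1 - z * x ^ 2) ∂μ) - 1 =
      z * (lam * (∫ x, 1 / (1 - z * x ^ 2) ∂μ) ^ 2 +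
        (1 - lam) * ∫ x, 1 / (1 - z * x ^ 2) ∂μ) := by
    have ht : Tendsto (fun z : ℝ => (z : ℂ)) (𝓝 0) (𝓝 0) := by
      simpa using Complex.continuous_ofReal.tendsto 0
    filter_upwards [ht.eventually hquad] with z hz
    rw [momentTransform_ofReal] at hz
    exact_mod_cast hz
  set a : ℕ → ℝ := fun k => ∫ x, x ^ (2 * k) ∂μ with ha
  have ha0 : a 0 = 1 := by simp [ha]
  -- `c` is the coefficient sequence of `m - 1 - z (lam m² + (1 - lam) m)`.
  let c : ℕ → ℝ := fun k => Nat.casesOn k 0 fun j =>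
    a (j + 1) - (lam * ∑ i ∈ Finset.range (j + 1), a i * a (j - i) + (1 - lam) * a j)
  have hc : c = 0 := by
    apply coeff_eq_zero_of_eventually_hasSum
    have hsmall : ∀ᶠ z in 𝓝 (0 : ℝ), |z| * R ^ 2 < 1 := by
      have : Tendsto (fun z : ℝ => |z| * R ^ 2) (𝓝 0) (𝓝 (|0| * R ^ 2)) :=
        (by fun_prop : Continuous fun z : ℝ => |z| * R ^ 2).tendsto _
      exact this.eventually_lt_const (by simp)
    filter_upwards [hquad', hsmall] with z hz hzR
    have hsum : HasSum (fun k => z ^ k * a k) (∫ x, 1 / (1 - z * x ^ 2) ∂μ) := by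
      have := hasSum_integral_div_one_sub (μ := μ) (f := fun _ => 1) (g := fun x => x ^ 2)
        (A := 1) (B := R ^ 2) (r := z) measurable_const (by fun_prop) (by simp)
        (by
          filter_upwards [hR] with x hx
          rw [abs_pow]
          gcongr) (sq_nonneg R) hzR
      simpa only [one_mul, ← pow_mul] using this
    set m := ∫ x, 1 / (1 - z * x ^ 2) ∂μ with hmdef
    have hconv : HasSum (fun k => z ^ k * ∑ i ∈ Finset.range (k + 1), a i * a (k - i)) (m ^ 2) := by
      have hs := hsum.summable.norm
      have h1 := (summable_norm_sum_mul_range_of_summable_norm hs hs).of_norm.hasSum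
      rw [← tsum_mul_tsum_eq_tsum_sum_range_of_summable_norm hs hs, hsum.tsum_eq,
        ← pow_two] at h1
      have e (k : ℕ) : z ^ k * ∑ i ∈ Finset.range (k + 1), a i * a (k - i) =
          ∑ i ∈ Finset.range (k + 1), z ^ i * a i * (z ^ (k - i) * a (k - i)) := by
        rw [Finset.mul_sum]
        refine Finset.sum_congr rfl fun i hi => ?_
        have : z ^ k = z ^ i * z ^ (k - i) := by
          rw [← pow_add, Nat.add_sub_of_le (Finset.mem_range_succ_iff.1 hi)]
        rw [this]
        ring
      simp only [e]
      exact h1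
    have hshift : HasSum (fun k => z ^ (k + 1) * a (k + 1)) (m - 1) := by
      have := (hasSum_nat_add_iff' 1).2 hsum
      simpa [ha0] using this
    have hrhs := (((hconv.mul_left lam).add (hsum.mul_left (1 - lam))).mul_left z)
    have hdiff := hshift.sub hrhs
    rw [hz, sub_self] at hdiff
    refine (hasSum_nat_add_iff' 1).1 ?_
    have e (k : ℕ) : z ^ (k + 1) * c (k + 1) = z ^ (k + 1) * a (k + 1) -
        z * (lam * (z ^ k * ∑ i ∈ Finset.range (k + 1), a i * a (k - i)) +
          (1 - lam) * (z ^ k * a k)) := by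
      simp only [c]
      ring
    have e0 : (0 : ℝ) - ∑ i ∈ Finset.range 1, z ^ i * c i = 0 := by simp [c]
    simp only [e, e0]
    exact hdiff
  have := congrFun hc (n + 1)
  exact sub_eq_zero.1 this

/-! ### Noncrossing pairings of intervals -/

/-- `P` is a noncrossing partition of `s` into blocks with two elements. -/
structure IsNCPairing (s : Finset ℕ) (P : Finset (Finset ℕ)) : Prop where
  card : ∀ V ∈ P, V.card = 2
  subset : ∀ V ∈ P, V ⊆ s
  cover : ∀ x ∈ s, ∃ V ∈ P, x ∈ V
  disj : ∀ V ∈ P, ∀ W ∈ P, ∀ x, x ∈ V → x ∈ W → V = W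
  nc : ∀ V ∈ P, ∀ W ∈ P, V ≠ W → ∀ a ∈ V, ∀ b ∈ W, ∀ c ∈ V, ∀ d ∈ W, ¬ (a < b ∧ b < c ∧ c < d)

open Classical in
/-- The noncrossing pairings of `s`. -/
def ncPairings (s : Finset ℕ) : Finset (Finset (Finset ℕ)) :=
  s.powerset.powerset.filter fun P => IsNCPairing s P

lemma mem_ncPairings {s : Finset ℕ} {P : Finset (Finset ℕ)} :
    P ∈ ncPairings s ↔ IsNCPairing s P := by
  classical
  unfold ncPairings
  rw [Finset.mem_filter, Finset.mem_powerset]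
  refine ⟨fun h => h.2, fun h => ⟨fun V hV => Finset.mem_powerset.2 (h.subset V hV), h⟩⟩

open Classical in
/-- The weight of a block: `lam` if its minimum is even and `1` otherwise. -/
def blockWeight (lam : ℝ) (V : Finset ℕ) : ℝ :=
  if ∃ a ∈ V, Even a ∧ ∀ b ∈ V, a ≤ b then lam else 1

/-- The sum over the noncrossing pairings of `s` of `lam` to the number of blocks with even
minimum. -/
def pairingSum (lam : ℝ) (s : Finset ℕ) : ℝ :=
  ∑ P ∈ ncPairings s, ∏ V ∈ P, blockWeight lam V

lemma blockWeight_pair (lam : ℝ) {a j : ℕ} (h : a < j) :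
    blockWeight lam {a, j} = if Even a then lam else 1 := by
  have : (∃ x ∈ ({a, j} : Finset ℕ), Even x ∧ ∀ b ∈ ({a, j} : Finset ℕ), x ≤ b) ↔ Even a := by
    constructor
    · rintro ⟨x, hx, he, hle⟩
      have h1 := hle a (by simp)
      rw [Finset.mem_insert, Finset.mem_singleton] at hx
      rcases hx with rfl | rfl
      · exact he
      · omega
    · refine fun he => ⟨a, by simp, he, fun b hb => ?_⟩
      rw [Finset.mem_insert, Finset.mem_singleton] at hb
      omega
  simp only [blockWeight, this]

namespace IsNCPairing

lemma nonempty {s : Finset ℕ} {P : Finset (Finset ℕ)} (h : IsNCPairing s P) {V : Finset ℕ}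
    (hV : V ∈ P) : V.Nonempty :=
  Finset.card_pos.1 (by rw [h.card V hV]; norm_num)

/-- Noncrossing pairings strictly between `a` and `j` and to the right of `j` combine with the block
`{a, j}` to a noncrossing pairing. -/
lemma glue {a j b : ℕ} {P Q : Finset (Finset ℕ)} (haj : a < j) (hjb : j < b)
    (hP : IsNCPairing (Finset.Ico (a + 1) j) P) (hQ : IsNCPairing (Finset.Ico (j + 1) b) Q) :
    IsNCPairing (Finset.Ico a b) (insert {a, j} (P ∪ Q)) := by
  have hP' : ∀ V ∈ P, ∀ x ∈ V, a < x ∧ x < j := fun V hV x hx => by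
    have := Finset.mem_Ico.1 (hP.subset V hV hx); omega
  have hQ' : ∀ V ∈ Q, ∀ x ∈ V, j < x ∧ x < b := fun V hV x hx => by
    have := Finset.mem_Ico.1 (hQ.subset V hV hx); omega
  constructor
  · intro V hV
    rw [Finset.mem_insert, Finset.mem_union] at hV
    rcases hV with rfl | hV | hV
    · exact Finset.card_pair haj.ne
    · exact hP.card V hV
    · exact hQ.card V hV
  · intro V hV x hx
    rw [Finset.mem_Ico]
    grind
  · intro x hx
    rw [Finset.mem_Ico] at hx
    rcases lt_trichotomy x j with h | h | h
    · rcases hx.1.eq_or_lt with h' | h'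
      · exact ⟨{a, j}, by simp, by simp [h']⟩
      · obtain ⟨V, hV, hxV⟩ := hP.cover x (Finset.mem_Ico.2 ⟨h', h⟩)
        exact ⟨V, by simp [hV], hxV⟩
    · exact ⟨{a, j}, by simp, by simp [h]⟩
    · obtain ⟨V, hV, hxV⟩ := hQ.cover x (Finset.mem_Ico.2 ⟨h, hx.2⟩)
      exact ⟨V, by simp [hV], hxV⟩
  · intro V hV W hW x hxV hxW
    have h1 := hP.disj
    have h2 := hQ.disj
    grind
  · intro V hV W hW hVW x hx y hy z hz t ht
    rw [Finset.mem_insert, Finset.mem_union] at hV hW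
    rcases hV with rfl | hV | hV <;> rcases hW with rfl | hW | hW
    · exact absurd rfl hVW
    · have := hP' W hW y hy
      have := hP' W hW t ht
      rw [Finset.mem_insert, Finset.mem_singleton] at hx hz
      omega
    · have := hQ' W hW y hy
      rw [Finset.mem_insert, Finset.mem_singleton] at hx hz
      omega
    · have := hP' V hV x hx
      have := hP' V hV z hz
      rw [Finset.mem_insert, Finset.mem_singleton] at hy ht
      omega
    · exact hP.nc V hV W hW hVW x hx y hy z hz t ht
    · have := hP' V hV z hz
      have := hQ' W hW y hy
      omega
    · have := hQ' V hV x hx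
      rw [Finset.mem_insert, Finset.mem_singleton] at hy ht
      omega
    · have := hQ' V hV x hx
      have := hP' W hW y hy
      omega
    · exact hQ.nc V hV W hW hVW x hx y hy z hz t ht

/-- Every block other than that of the least element `a` lies either inside or outside. -/
lemma inside_or_outside {a j b : ℕ} {R : Finset (Finset ℕ)} (hR : IsNCPairing (Finset.Ico a b) R)
    (haj : a < j) (hj : {a, j} ∈ R) {V : Finset ℕ} (hV : V ∈ R) (hne : V ≠ {a, j}) :
    V ⊆ Finset.Ico (a + 1) j ∨ V ⊆ Finset.Ico (j + 1) b := by
  have hmem : ∀ x ∈ V, a < x ∧ x < b ∧ x ≠ j := by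
    intro x hx
    have h1 := Finset.mem_Ico.1 (hR.subset V hV hx)
    have h2 : x ≠ a := fun h => hne (hR.disj V hV _ hj x hx (by simp [h]))
    have h3 : x ≠ j := fun h => hne (hR.disj V hV _ hj x hx (by simp [h]))
    omega
  by_cases h : ∃ x ∈ V, x < j
  · left
    obtain ⟨x, hx, hxj⟩ := h
    intro y hy
    rw [Finset.mem_Ico]
    have h1 := hR.nc _ hj V hV hne.symm a (by simp) x hx j (by simp) y hy
    have h2 := hmem x hx
    have h3 := hmem y hy
    omega
  · right
    push Not at h
    intro y hy
    rw [Finset.mem_Ico]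
    have h1 := h y hy
    have h3 := hmem y hy
    omega

/-- If `t` is a union of blocks, the blocks inside `t` form a noncrossing pairing of `t`. -/
lemma restrict {s t : Finset ℕ} {R : Finset (Finset ℕ)} (hR : IsNCPairing s R) (hts : t ⊆ s)
    (h : ∀ V ∈ R, (∃ x ∈ V, x ∈ t) → V ⊆ t) : IsNCPairing t (R.filter (· ⊆ t)) := by
  constructor
  · exact fun V hV => hR.card V (Finset.mem_filter.1 hV).1
  · exact fun V hV => (Finset.mem_filter.1 hV).2
  · intro x hx
    obtain ⟨V, hV, hxV⟩ := hR.cover x (hts hx)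
    exact ⟨V, Finset.mem_filter.2 ⟨hV, h V hV ⟨x, hxV, hx⟩⟩, hxV⟩
  · exact fun V hV W hW => hR.disj V (Finset.mem_filter.1 hV).1 W (Finset.mem_filter.1 hW).1
  · exact fun V hV W hW => hR.nc V (Finset.mem_filter.1 hV).1 W (Finset.mem_filter.1 hW).1

/-- The two parts can be recovered from the combined pairing. -/
lemma filter_glue {a j b : ℕ} {P Q : Finset (Finset ℕ)}
    (hP : IsNCPairing (Finset.Ico (a + 1) j) P) (hQ : IsNCPairing (Finset.Ico (j + 1) b) Q) :
    (insert {a, j} (P ∪ Q)).filter (· ⊆ Finset.Ico (a + 1) j) = P ∧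
      (insert {a, j} (P ∪ Q)).filter (· ⊆ Finset.Ico (j + 1) b) = Q := by
  constructor
  · ext V
    simp only [Finset.mem_filter, Finset.mem_insert, Finset.mem_union]
    constructor
    · rintro ⟨rfl | hV | hV, hs⟩
      · have := Finset.mem_Ico.1 (hs (by simp : a ∈ ({a, j} : Finset ℕ)))
        omega
      · exact hV
      · obtain ⟨x, hx⟩ := hQ.nonempty hV
        have h1 := Finset.mem_Ico.1 (hs hx)
        have h2 := Finset.mem_Ico.1 (hQ.subset V hV hx)
        omega
    · exact fun hV => ⟨Or.inr (Or.inl hV), hP.subset V hV⟩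
  · ext V
    simp only [Finset.mem_filter, Finset.mem_insert, Finset.mem_union]
    constructor
    · rintro ⟨rfl | hV | hV, hs⟩
      · have := Finset.mem_Ico.1 (hs (by simp : j ∈ ({a, j} : Finset ℕ)))
        omega
      · obtain ⟨x, hx⟩ := hP.nonempty hV
        have h1 := Finset.mem_Ico.1 (hs hx)
        have h2 := Finset.mem_Ico.1 (hP.subset V hV hx)
        omega
      · exact hV
    · exact fun hV => ⟨Or.inr (Or.inr hV), hQ.subset V hV⟩

end IsNCPairing

/-- Decomposition of a noncrossing pairing of an interval according to the block `{a, j}` of its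
least element. -/
lemma pairingSum_Ico (lam : ℝ) {a b : ℕ} (hab : a < b) :
    pairingSum lam (Finset.Ico a b) = ∑ j ∈ Finset.Ico (a + 1) b, (if Even a then lam else 1) *
      (pairingSum lam (Finset.Ico (a + 1) j) * pairingSum lam (Finset.Ico (j + 1) b)) := by
  have hrhs : ∀ j, (if Even a then lam else 1) *
      (pairingSum lam (Finset.Ico (a + 1) j) * pairingSum lam (Finset.Ico (j + 1) b)) =
      ∑ p ∈ ncPairings (Finset.Ico (a + 1) j) ×ˢ ncPairings (Finset.Ico (j + 1) b),
        (if Even a then lam else 1) *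
          ((∏ V ∈ p.1, blockWeight lam V) * ∏ V ∈ p.2, blockWeight lam V) := by
    intro j
    rw [pairingSum, pairingSum, Finset.sum_mul_sum, ← Finset.sum_product', Finset.mul_sum]
  simp_rw [hrhs]
  rw [Finset.sum_sigma', pairingSum]
  symm
  refine Finset.sum_bij (fun x _ => insert {a, x.1} (x.2.1 ∪ x.2.2)) ?_ ?_ ?_ ?_
  · rintro ⟨j, P, Q⟩ hx
    simp only [Finset.mem_sigma, Finset.mem_product, mem_ncPairings, Finset.mem_Ico] at hx
    exact mem_ncPairings.2 (IsNCPairing.glue hx.1.1 hx.1.2 hx.2.1 hx.2.2)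
  · rintro ⟨j, P, Q⟩ hx ⟨j', P', Q'⟩ hx' h
    simp only [Finset.mem_sigma, Finset.mem_product, mem_ncPairings, Finset.mem_Ico] at hx hx' h
    have hglue := IsNCPairing.glue hx.1.1 hx.1.2 hx.2.1 hx.2.2
    have hpair : ({a, j} : Finset ℕ) = {a, j'} :=
      hglue.disj _ (by simp) _ (h ▸ Finset.mem_insert_self _ _) a (by simp) (by simp)
    have hj : j = j' := by
      have h1 : j ∈ ({a, j'} : Finset ℕ) := hpair ▸ (by simp)
      rw [Finset.mem_insert, Finset.mem_singleton] at h1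
      omega
    subst hj
    obtain ⟨h1, h2⟩ := IsNCPairing.filter_glue hx.2.1 hx.2.2
    obtain ⟨h3, h4⟩ := IsNCPairing.filter_glue hx'.2.1 hx'.2.2
    rw [h] at h1 h2
    rw [← h1, ← h2, h3, h4]
  · intro R hR
    rw [mem_ncPairings] at hR
    obtain ⟨V, hV, haV⟩ := hR.cover a (Finset.mem_Ico.2 ⟨le_rfl, hab⟩)
    obtain ⟨j, hj, hja⟩ := Finset.exists_mem_ne (by rw [hR.card V hV]; norm_num) a
    have hjI := Finset.mem_Ico.1 (hR.subset V hV hj)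
    have hVeq : V = {a, j} := by
      symm
      apply Finset.eq_of_subset_of_card_le
      · intro x hx
        rw [Finset.mem_insert, Finset.mem_singleton] at hx
        rcases hx with rfl | rfl <;> assumption
      · rw [hR.card V hV, Finset.card_pair hja.symm]
    subst hVeq
    have haj : a < j := by omega
    have hio := fun {W} (hW : W ∈ R) (hne : W ≠ {a, j}) => hR.inside_or_outside haj hV hW hne
    refine ⟨⟨j, R.filter (· ⊆ Finset.Ico (a + 1) j), R.filter (· ⊆ Finset.Ico (j + 1) b)⟩, ?_, ?_⟩
    · simp only [Finset.mem_sigma, Finset.mem_product, mem_ncPairings, Finset.mem_Ico]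
      refine ⟨by omega, hR.restrict (Finset.Ico_subset_Ico (by omega) (by omega)) ?_,
        hR.restrict (Finset.Ico_subset_Ico (by omega) (by omega)) ?_⟩
      · rintro W hW ⟨x, hxW, hx⟩
        rw [Finset.mem_Ico] at hx
        have hne : W ≠ {a, j} := by
          rintro rfl
          rw [Finset.mem_insert, Finset.mem_singleton] at hxW
          omega
        refine (hio hW hne).resolve_right fun h => ?_
        have := Finset.mem_Ico.1 (h hxW)
        omega
      · rintro W hW ⟨x, hxW, hx⟩
        rw [Finset.mem_Ico] at hx
        have hne : W ≠ {a, j} := by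
          rintro rfl
          rw [Finset.mem_insert, Finset.mem_singleton] at hxW
          omega
        refine (hio hW hne).resolve_left fun h => ?_
        have := Finset.mem_Ico.1 (h hxW)
        omega
    · ext W
      simp only [Finset.mem_insert, Finset.mem_union, Finset.mem_filter]
      constructor
      · rintro (rfl | h | h)
        · exact hV
        · exact h.1
        · exact h.1
      · intro hW
        by_cases hne : W = {a, j}
        · exact Or.inl hne
        · exact Or.inr ((hio hW hne).imp (fun h => ⟨hW, h⟩) fun h => ⟨hW, h⟩)
  · rintro ⟨j, P, Q⟩ hx
    simp only [Finset.mem_sigma, Finset.mem_product, mem_ncPairings, Finset.mem_Ico] at hx ⊢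
    obtain ⟨hj, hP, hQ⟩ := hx
    rw [Finset.prod_insert, Finset.prod_union, blockWeight_pair lam hj.1]
    · rw [Finset.disjoint_left]
      intro V hV hV'
      obtain ⟨x, hx⟩ := hP.nonempty hV
      have h1 := Finset.mem_Ico.1 (hP.subset V hV hx)
      have h2 := Finset.mem_Ico.1 (hQ.subset V hV' hx)
      omega
    · intro h
      rcases Finset.mem_union.1 h with h | h
      · have := Finset.mem_Ico.1 (hP.subset _ h (by simp : a ∈ ({a, j} : Finset ℕ)))
        omega
      · have := Finset.mem_Ico.1 (hQ.subset _ h (by simp : a ∈ ({a, j} : Finset ℕ)))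
        omega

lemma sum_range_two_mul_add_one {f : ℕ → ℝ} (hf : ∀ i, Odd i → f i = 0) (n : ℕ) :
    ∑ i ∈ Finset.range (2 * n + 1), f i = ∑ k ∈ Finset.range (n + 1), f (2 * k) := by
  induction n with
  | zero => simp
  | succ n ih =>
    rw [Finset.sum_range_succ (fun k => f (2 * k)), ← ih, show 2 * (n + 1) + 1 = 2 * n + 1 + 1 + 1
      by ring, Finset.sum_range_succ, Finset.sum_range_succ, hf (2 * n + 1) ⟨n, rfl⟩, add_zero]
    rfl

lemma pairingSum_empty (lam : ℝ) : pairingSum lam ∅ = 1 := by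
  have : ncPairings ∅ = {∅} := by
    ext P
    rw [mem_ncPairings, Finset.mem_singleton]
    constructor
    · intro h
      rw [Finset.eq_empty_iff_forall_notMem]
      intro V hV
      obtain ⟨x, hx⟩ := h.nonempty hV
      exact absurd (h.subset V hV hx) (Finset.notMem_empty x)
    · rintro rfl
      constructor <;> simp
  rw [pairingSum, this]
  simp

lemma pairingSum_Ico_add (lam : ℝ) (p l : ℕ) : pairingSum lam (Finset.Ico p (p + (l + 1))) =
    ∑ i ∈ Finset.range l, (if Even p then lam else 1) *
      (pairingSum lam (Finset.Ico (p + 1) (p + 1 + i)) *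
        pairingSum lam (Finset.Ico (p + i + 2) (p + i + 2 + (l - 1 - i)))) := by
  rw [pairingSum_Ico lam (by omega), Finset.sum_Ico_eq_sum_range]
  have : p + (l + 1) - (p + 1) = l := by omega
  rw [this]
  refine Finset.sum_congr rfl fun i hi => ?_
  rw [Finset.mem_range] at hi
  have h1 : p + 1 + i + 1 = p + i + 2 := by omega
  have h2 : p + (l + 1) = p + i + 2 + (l - 1 - i) := by omega
  rw [h1, ← h2]

/-- An interval of odd length has no pairing. -/
lemma pairingSum_odd (lam : ℝ) {l : ℕ} (hl : Odd l) (p : ℕ) :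
    pairingSum lam (Finset.Ico p (p + l)) = 0 := by
  induction l using Nat.strong_induction_on generalizing p with
  | _ l ih =>
    obtain ⟨n, rfl⟩ := hl
    rw [pairingSum_Ico_add]
    refine Finset.sum_eq_zero fun i hi => ?_
    rw [Finset.mem_range] at hi
    rcases Nat.even_or_odd i with h | h
    · have : Odd (2 * n - 1 - i) := by
        rw [Nat.odd_iff]; rw [Nat.even_iff] at h; omega
      rw [ih _ (by omega) this, mul_zero, mul_zero]
    · rw [ih _ (by omega) h, zero_mul, mul_zero]

/-- Shifting an interval by one exchanges the blocks with even and odd minimum, hence the two cases: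
the generating series `A` of `a` satisfies `A = 1 + z B A` with `B = lam A + 1 - lam`. -/
lemma pairingSum_even {lam : ℝ} {a : ℕ → ℝ} (h0 : a 0 = 1)
    (ha : ∀ n, a (n + 1) = lam * ∑ k ∈ Finset.range (n + 1), a k * a (n - k) + (1 - lam) * a n)
    (n p : ℕ) : pairingSum lam (Finset.Ico p (p + 2 * n)) =
      if Even p then lam * a n + (if n = 0 then 1 - lam else 0) else a n := by
  induction n using Nat.strong_induction_on generalizing p with
  | _ n ih =>
    rcases n with _ | n
    · simp [pairingSum_empty, h0]
    have hodd (i : ℕ) (hi : Odd i) : (if Even p then lam else 1) *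
        (pairingSum lam (Finset.Ico (p + 1) (p + 1 + i)) *
        pairingSum lam (Finset.Ico (p + i + 2) (p + i + 2 + (2 * n + 1 - 1 - i)))) = 0 := by
      rw [pairingSum_odd lam hi, zero_mul, mul_zero]
    have hrec : pairingSum lam (Finset.Ico p (p + 2 * (n + 1))) =
        ∑ k ∈ Finset.range (n + 1), (if Even p then lam else 1) *
          ((if Even (p + 1) then lam * a k + (if k = 0 then 1 - lam else 0) else a k) *
          (if Even p then lam * a (n - k) + (if n - k = 0 then 1 - lam else 0)
            else a (n - k))) := by
      rw [show 2 * (n + 1) = 2 * n + 1 + 1 by ring, pairingSum_Ico_add,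
        sum_range_two_mul_add_one hodd]
      refine Finset.sum_congr rfl fun k hk => ?_
      rw [Finset.mem_range] at hk
      have h1 : 2 * n + 1 - 1 - 2 * k = 2 * (n - k) := by omega
      have h2 : Even (p + 2 * k + 2) ↔ Even p := by
        rw [Nat.even_iff, Nat.even_iff]; omega
      rw [h1, ih k (by omega), ih (n - k) (by omega)]
      simp only [h2]
    rw [hrec]
    by_cases hp : Even p
    · have hp1 : ¬ Even (p + 1) := by rwa [Nat.even_add_one, not_not]
      simp only [if_pos hp, if_neg hp1, Nat.succ_ne_zero, if_false, add_zero]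
      rw [← Finset.mul_sum, ha]
      congr 1
      have hlast : ∑ k ∈ Finset.range (n + 1), a k * (if n - k = 0 then 1 - lam else 0) =
          (1 - lam) * a n := by
        rw [Finset.sum_eq_single n]
        · simp [mul_comm]
        · intro k hk hkn
          rw [Finset.mem_range] at hk
          rw [if_neg (by omega), mul_zero]
        · intro h
          exact absurd (Finset.mem_range.2 (by omega)) h
      rw [← hlast, Finset.mul_sum, ← Finset.sum_add_distrib]
      refine Finset.sum_congr rfl fun k _ => ?_
      ring
    · have hp1 : Even (p + 1) := by rwa [Nat.even_add_one]
      simp only [if_neg hp, if_pos hp1, one_mul]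
      rw [ha]
      have hfirst : ∑ k ∈ Finset.range (n + 1), (if k = 0 then 1 - lam else 0) * a (n - k) =
          (1 - lam) * a n := by
        rw [Finset.sum_eq_single 0]
        · simp
        · intro k _ hk
          rw [if_neg hk, zero_mul]
        · intro h
          exact absurd (Finset.mem_range.2 (by omega)) h
      rw [← hfirst, Finset.mul_sum, ← Finset.sum_add_distrib]
      refine Finset.sum_congr rfl fun k _ => ?_
      ring

/-! ### Cumulants -/

lemma mem_evenNC {m : ℕ} {π : Part m} :
    π ∈ evenNC m ↔ IsNoncrossing π ∧ ∀ V ∈ π.parts, Even V.card := by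
  simp [evenNC]

lemma pow_evenMinBlocks (lam : ℝ) {m : ℕ} (π : Part m) :
    lam ^ evenMinBlocks π = ∏ V ∈ π.parts, blockWeight lam V := by
  simp only [blockWeight, evenMinBlocks]
  rw [Finset.prod_ite]
  simp

lemma isNCPairing_parts {m : ℕ} {π : Part m} (h : IsNoncrossing π)
    (h2 : ∀ V ∈ π.parts, V.card = 2) : IsNCPairing (Finset.Icc 1 m) π.parts where
  card := h2
  subset _ hV := π.le hV
  cover _ hx := π.exists_mem hx
  disj _ hV _ hW _ hxV hxW := π.eq_of_mem_parts hV hW hxV hxW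
  nc := h

/-- When only the cumulant of order two is nonzero, the noncrossing pairings alone contribute. -/
lemma sum_evenNC_eq_pairingSum (lam : ℝ) {c : ℕ → ℝ}
    (hc : ∀ n : ℕ, 1 ≤ n → c n = if n = 1 then 1 else 0) (m : ℕ) :
    ∑ π ∈ evenNC m, lam ^ evenMinBlocks π * ∏ V ∈ π.parts, c (V.card / 2) =
      pairingSum lam (Finset.Icc 1 m) := by
  classical
  have hpos {π : Part m} {V : Finset ℕ} (hV : V ∈ π.parts) : 0 < V.card :=
    Finset.card_pos.2 (π.nonempty_of_mem_parts hV)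
  rw [← Finset.sum_subset (Finset.filter_subset (fun π : Part m => ∀ V ∈ π.parts, V.card = 2)
    (evenNC m))]
  · refine Finset.sum_bij (fun π _ => π.parts) ?_ ?_ ?_ ?_
    · intro π hπ
      rw [Finset.mem_filter, mem_evenNC] at hπ
      exact mem_ncPairings.2 (isNCPairing_parts hπ.1.1 hπ.2)
    · intro π _ π' _ h
      exact Finpartition.ext h
    · intro P hP
      rw [mem_ncPairings] at hP
      refine ⟨⟨P, ?_, ?_, ?_⟩, ?_, rfl⟩
      · rw [Finset.supIndep_iff_pairwiseDisjoint]
        intro V hV W hW hVW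
        rw [Function.onFun, id, id, Finset.disjoint_left]
        exact fun x hxV hxW => hVW (hP.disj V hV W hW x hxV hxW)
      · ext x
        rw [Finset.mem_sup]
        constructor
        · rintro ⟨V, hV, hxV⟩
          exact hP.subset V hV hxV
        · exact fun hx => hP.cover x hx
      · intro h
        have := hP.card _ h
        simp at this
      · rw [Finset.mem_filter, mem_evenNC]
        exact ⟨⟨hP.nc, fun V hV => by rw [hP.card V hV]; exact even_two⟩, hP.card⟩
    · intro π hπ
      rw [Finset.mem_filter] at hπ
      have h1 : ∏ V ∈ π.parts, c (V.card / 2) = 1 := Finset.prod_eq_one fun V hV => by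
        rw [hπ.2 V hV, hc _ (by norm_num)]
        simp
      rw [pow_evenMinBlocks, h1, mul_one]
  · intro π hπ hπ2
    have : ∃ V ∈ π.parts, V.card ≠ 2 := by
      by_contra h
      push Not at h
      exact hπ2 (Finset.mem_filter.2 ⟨hπ, h⟩)
    obtain ⟨V, hV, hV2⟩ := this
    have h1 := hpos hV
    obtain ⟨r, hr⟩ := (mem_evenNC.1 hπ).2 V hV
    rw [Finset.prod_eq_zero hV, mul_zero]
    rw [hc _ (by omega), if_neg (by omega)]

/-- The moment-cumulant relations determine the cumulants recursively, because the partition with a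
single block contributes the cumulant of highest order with coefficient `1`. -/
lemma cumulants_unique {lam : ℝ} {μ : Measure ℝ} {c d : ℕ → ℝ} (hc : IsRectCumulants lam μ c)
    (hd : IsRectCumulants lam μ d) {n : ℕ} (hn : 1 ≤ n) : c n = d n := by
  classical
  induction n using Nat.strong_induction_on with
  | _ n ih =>
    have heq := (hc.2 n hn).symm.trans (hd.2 n hn)
    have hne : Finset.Icc 1 (2 * n) ≠ ⊥ := by
      rw [Finset.bot_eq_empty, ← Finset.nonempty_iff_ne_empty, Finset.nonempty_Icc]
      omega
    have hmem : (Finpartition.indiscrete hne : Part (2 * n)) ∈ evenNC (2 * n) := by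
      rw [mem_evenNC]
      constructor
      · intro V hV W hW hVW
        rw [Finpartition.indiscrete_parts, Finset.mem_singleton] at hV hW
        exact absurd (hV.trans hW.symm) hVW
      · intro V hV
        rw [Finpartition.indiscrete_parts, Finset.mem_singleton] at hV
        rw [hV, Nat.card_Icc]
        exact ⟨n, by omega⟩
    have htop (e : ℕ → ℝ) : lam ^ evenMinBlocks (Finpartition.indiscrete hne : Part (2 * n)) *
        ∏ V ∈ (Finpartition.indiscrete hne : Part (2 * n)).parts, e (V.card / 2) = e n := by
      have h1 : blockWeight lam (Finset.Icc 1 (2 * n)) = 1 := by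
        rw [blockWeight, if_neg]
        rintro ⟨x, hx, he, hle⟩
        have h2 := hle 1 (Finset.mem_Icc.2 ⟨le_rfl, by omega⟩)
        have h3 := (Finset.mem_Icc.1 hx).1
        rw [Nat.even_iff] at he
        omega
      rw [pow_evenMinBlocks, Finpartition.indiscrete_parts, Finset.prod_singleton,
        Finset.prod_singleton, h1, one_mul, Nat.card_Icc]
      congr 1
      omega
    -- The blocks of all other partitions are smaller, so their cumulants agree by induction.
    have hrest : ∑ π ∈ (evenNC (2 * n)).erase (Finpartition.indiscrete hne),
        lam ^ evenMinBlocks π * ∏ V ∈ π.parts, c (V.card / 2) =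
        ∑ π ∈ (evenNC (2 * n)).erase (Finpartition.indiscrete hne),
        lam ^ evenMinBlocks π * ∏ V ∈ π.parts, d (V.card / 2) := by
      refine Finset.sum_congr rfl fun π hπ => ?_
      rw [Finset.mem_erase, mem_evenNC] at hπ
      congr 1
      refine Finset.prod_congr rfl fun V hV => ?_
      have h1 : 0 < V.card := Finset.card_pos.2 (π.nonempty_of_mem_parts hV)
      have h2 : V.card < 2 * n := by
        have hsub : V ⊆ Finset.Icc 1 (2 * n) := π.le hV
        have hle := Finset.card_le_card hsub
        rw [Nat.card_Icc] at hle
        refine lt_of_le_of_ne (by omega) fun h => hπ.1 ?_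
        have hVeq : V = Finset.Icc 1 (2 * n) :=
          Finset.eq_of_subset_of_card_le hsub (by rw [Nat.card_Icc]; omega)
        ext W
        rw [Finpartition.indiscrete_parts, Finset.mem_singleton]
        constructor
        · intro hW
          obtain ⟨x, hx⟩ := π.nonempty_of_mem_parts hW
          have hxV : x ∈ V := hVeq ▸ (π.le hW hx)
          exact (π.eq_of_mem_parts hW hV hx hxV).trans hVeq
        · exact fun hW => (hVeq.trans hW.symm) ▸ hV
      obtain ⟨r, hr⟩ := hπ.2.2 V hV
      exact ih _ (by omega) (by omega)
    rw [← Finset.add_sum_erase _ _ hmem, ← Finset.add_sum_erase _ _ hmem, hrest, htop, htop] at heq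
    exact add_right_cancel heq

/-- A compactly supported law `μ` with `m_μ(F(w)) = 1 + w` near zero has free cumulants with ratio
`lam` equal to `1, 0, 0, …`. -/
lemma isRectCumulants_iff {lam R : ℝ} {μ : Measure ℝ} [IsProbabilityMeasure μ]
    (hR : ∀ᵐ x ∂μ, |x| ≤ R)
    (hm : ∀ᶠ w in 𝓝 (0 : ℂ), momentTransform μ (ratInv lam 1 w) = 1 + w) (c : ℕ → ℝ) :
    IsRectCumulants lam μ c ↔ ∀ n : ℕ, 1 ≤ n → c n = if n = 1 then 1 else 0 := by
  have hif {d : ℕ → ℝ} (hd : ∀ n : ℕ, 1 ≤ n → d n = if n = 1 then 1 else 0) :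
      IsRectCumulants lam μ d := by
    refine ⟨integrable_pow_of_ae_abs_le hR, fun n _ => ?_⟩
    rw [sum_evenNC_eq_pairingSum lam hd]
    have h1 : Finset.Icc 1 (2 * n) = Finset.Ico 1 (1 + 2 * n) := by
      ext x
      rw [Finset.mem_Icc, Finset.mem_Ico]
      omega
    rw [h1, pairingSum_even (a := fun k => ∫ x, x ^ (2 * k) ∂μ) (by simp)
      (moment_recursion hR hm), if_neg (by decide)]
  refine ⟨fun h n hn => ?_, hif⟩
  exact cumulants_unique h (hif (d := fun n => if n = 1 then 1 else 0) fun _ _ => rfl) hn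

/-! ### Infinite divisibility -/

lemma isSymmProb_gaussianReal : IsSymmProb (gaussianReal 0 1) := by
  refine ⟨inferInstance, ⟨?_⟩⟩
  have := gaussianReal_map_neg (μ := 0) (v := 1)
  rwa [neg_zero] at this

lemma isInfDiv_gaussianReal : IsInfDiv (gaussianReal 0 1) := by
  intro n hn
  have key (v : NNReal) (k : ℕ) : convPow (gaussianReal 0 v) k = gaussianReal 0 (k * v) := by
    induction k with
    | zero => simp [convPow]
    | succ k ih =>
      rw [convPow, ih, gaussianReal_conv_gaussianReal]
      congr 1
      · simp
      · push_cast
        ring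
  refine ⟨gaussianReal 0 (1 / n), inferInstance, ?_⟩
  rw [key]
  congr 1
  have : (n : NNReal) ≠ 0 := by
    rw [Nat.cast_ne_zero]
    omega
  field_simp

/-- The law of `√a X` for a random variable `X` with law `ν`. -/
def scaleLaw (a : ℝ) (ν : Measure ℝ) : Measure ℝ := ν.map fun x => √a * x

lemma scaleLaw_zero (ν : Measure ℝ) [IsProbabilityMeasure ν] :
    scaleLaw 0 ν = Measure.dirac 0 := by
  simp [scaleLaw, Measure.map_const]

lemma scaleLaw_one (ν : Measure ℝ) : scaleLaw 1 ν = ν := by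
  simp [scaleLaw]

lemma isSymmProb_scaleLaw {ν : Measure ℝ} (hν : IsSymmProb ν) (a : ℝ) :
    IsSymmProb (scaleLaw a ν) := by
  have := hν.prob
  have := hν.symm
  refine ⟨Measure.isProbabilityMeasure_map (by fun_prop), ⟨?_⟩⟩
  have h : ν.map Neg.neg = ν := Measure.neg_eq_self ν
  rw [Measure.neg, scaleLaw, Measure.map_map measurable_neg (by fun_prop)]
  nth_rewrite 2 [← h]
  rw [Measure.map_map (by fun_prop) measurable_neg]
  congr 1
  funext x
  simp

/-- Scaling a law with rectangular `R`-transform `z ↦ z` by `√a` gives the transform `z ↦ a z`. -/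
lemma isRectR_scaleLaw {lam R : ℝ} (hlam : 0 ≤ lam) {ν : Measure ℝ} (hν : IsSymmProb ν)
    (hR : ∀ᵐ x ∂ν, |x| ≤ R)
    (hm : ∀ᶠ w in 𝓝 (0 : ℂ), momentTransform ν (ratInv lam 1 w) = 1 + w) {a : ℝ} (ha : 0 ≤ a) :
    IsRectR lam (scaleLaw a ν) (fun z => a * z) := by
  refine isRectR_of_momentTransform (R := √a * R) hlam (isSymmProb_scaleLaw hν a) ?_ ?_
  · rw [scaleLaw, ae_map_iff (by fun_prop) (measurableSet_le (by fun_prop) (by fun_prop))]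
    filter_upwards [hR] with x hx
    rw [abs_mul, abs_of_nonneg (Real.sqrt_nonneg a)]
    gcongr
  · have ht : Tendsto (fun z : ℂ => a * z) (𝓝 0) (𝓝 0) := by
      have : ContinuousAt (fun z : ℂ => a * z) 0 := by fun_prop
      simpa [ContinuousAt] using this
    filter_upwards [ht.eventually hm] with z hz
    rw [← hz, momentTransform, momentTransform, scaleLaw, integral_map (by fun_prop)
      (Measurable.aestronglyMeasurable (by fun_prop))]
    congr 1
    funext x
    have h1 : ((√a : ℝ) : ℂ) ^ 2 = a := by
      rw [← Complex.ofReal_pow, Real.sq_sqrt ha]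
    have h2 : a * ratInv lam a z = ratInv lam 1 (a * z) := by
      simp [ratInv, mul_div_assoc]
    rw [← h2]
    push_cast
    rw [mul_pow, h1]
    ring

lemma isRectInfDiv_of_momentTransform {lam R : ℝ} (hlam : 0 ≤ lam) {ν : Measure ℝ}
    (hν : IsSymmProb ν) (hR : ∀ᵐ x ∂ν, |x| ≤ R)
    (hm : ∀ᶠ w in 𝓝 (0 : ℂ), momentTransform ν (ratInv lam 1 w) = 1 + w) :
    IsRectInfDiv lam ν := by
  have := hν.prob
  intro n hn
  refine ⟨scaleLaw (1 / n) ν, isSymmProb_scaleLaw hν _, ?_⟩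
  have key (k : ℕ) : IsRectConvPow lam (scaleLaw (1 / n) ν) k (scaleLaw (k / n) ν) := by
    induction k with
    | zero =>
      rw [IsRectConvPow, Nat.cast_zero, zero_div, scaleLaw_zero]
    | succ k ih =>
      refine ⟨_, ih, isSymmProb_scaleLaw hν _, isSymmProb_scaleLaw hν _, isSymmProb_scaleLaw hν _,
        _, _, isRectR_scaleLaw hlam hν hR hm (by positivity),
        isRectR_scaleLaw hlam hν hR hm (by positivity), ?_⟩
      have h := isRectR_scaleLaw hlam hν hR hm (a := (k + 1 : ℕ) / n) (by positivity)
      have e : (fun z : ℂ => (((k + 1 : ℕ) / n : ℝ) : ℂ) * z) =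
          fun z => ((k / n : ℝ) : ℂ) * z + ((1 / n : ℝ) : ℂ) * z := by
        funext z
        push_cast
        ring
      rwa [e] at h
  have hn0 : (n : ℝ) ≠ 0 := by
    rw [Nat.cast_ne_zero]
    omega
  have := key n
  rwa [div_self hn0, scaleLaw_one] at this

/-! ### The image of the Gaussian law -/

lemma isRectBercoviciPata_of_momentTransform {lam R : ℝ} (hlam : 0 ≤ lam) {ν : Measure ℝ}
    (hν : IsSymmProb ν) (hR : ∀ᵐ x ∂ν, |x| ≤ R)
    (hm : ∀ᶠ w in 𝓝 (0 : ℂ), momentTransform ν (ratInv lam 1 w) = 1 + w) :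
    IsRectBercoviciPata lam (gaussianReal 0 1) ν where
  symm_left := isSymmProb_gaussianReal
  infDiv_left := isInfDiv_gaussianReal
  symm_right := hν
  infDiv_right := isRectInfDiv_of_momentTransform hlam hν hR hm
  levy := by
    refine ⟨Measure.dirac 0, isLevyMeasure_gaussianReal, isLevyMeasure_gaussianReal.1, ?_⟩
    have h := isRectR_of_momentTransform hlam hν hR (a := 1) (by simpa using hm)
    simpa using h

lemma IsRectBercoviciPata.eq {lam : ℝ} (hlam0 : 0 ≤ lam) (hlam1 : lam ≤ 1) {μ ν : Measure ℝ}
    (hμ : IsRectBercoviciPata lam (gaussianReal 0 1) μ)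
    (hν : IsRectBercoviciPata lam (gaussianReal 0 1) ν) : μ = ν := by
  have key {κ : Measure ℝ} (hκ : IsRectBercoviciPata lam (gaussianReal 0 1) κ) :
      IsRectR lam κ (fun z => z) := by
    obtain ⟨G, hG, -, h⟩ := hκ.levy
    rw [eq_dirac_of_isLevyMeasure hG] at h
    simpa using h
  exact isRectR_id_unique hlam0 hlam1 hμ.symm_right hν.symm_right (key hμ) (key hν)

end

end RectFree

theorem mainTheorem6 (lam : ℝ) (hlam0 : 0 ≤ lam) (hlam1 : lam ≤ 1) :
    (∃! ν : Measure ℝ, RectFree.IsRectBercoviciPata lam (gaussianReal 0 1) ν) ∧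
    ∀ ν : Measure ℝ, RectFree.IsRectBercoviciPata lam (gaussianReal 0 1) ν →
      (∀ c : ℕ → ℝ, RectFree.IsRectCumulants lam ν c ↔
        ∀ n : ℕ, 1 ≤ n → c n = if n = 1 then 1 else 0) ∧
      (lam = 0 → ν = (2⁻¹ : ENNReal) • (Measure.dirac 1 + Measure.dirac (-1))) ∧
      (0 < lam →
        ν = volume.withDensity (fun x => ENNReal.ofReal (RectFree.rectGaussianDensity lam x)) ∧
        ν.support = Set.Icc (-1 - √lam) (-1 + √lam) ∪ Set.Icc (1 - √lam) (1 + √lam) ∧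
        ν.map (fun x => x ^ 2) =
          (RectFree.marchenkoPastur (1 / lam)).map (fun t => lam * t)) := by
  obtain ⟨ν₀, hsymm, hR, hm, h0, hpos⟩ : ∃ ν₀ : Measure ℝ, RectFree.IsSymmProb ν₀ ∧
      (∀ᵐ x ∂ν₀, |x| ≤ 2) ∧ (∀ᶠ w in 𝓝 (0 : ℂ),
        RectFree.momentTransform ν₀ (RectFree.ratInv lam 1 w) = 1 + w) ∧
      (lam = 0 → ν₀ = (2⁻¹ : ENNReal) • (Measure.dirac 1 + Measure.dirac (-1))) ∧
      (0 < lam → ν₀ = RectFree.rectGaussian lam) := by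
    rcases hlam0.eq_or_lt with rfl | hlam
    · exact ⟨_, RectFree.isSymmProb_bernoulli, RectFree.ae_bernoulli_abs_le,
        RectFree.momentTransform_bernoulli, fun _ => rfl, fun h => absurd h (lt_irrefl _)⟩
    · exact ⟨_, RectFree.isSymmProb_rectGaussian hlam hlam1, RectFree.ae_rectGaussian_abs_le hlam1,
        RectFree.momentTransform_rectGaussian hlam hlam1, fun h => absurd h hlam.ne', fun _ => rfl⟩
  have hν₀ := RectFree.isRectBercoviciPata_of_momentTransform hlam0 hsymm hR hm
  refine ⟨⟨ν₀, hν₀, fun μ hμ => hμ.eq hlam0 hlam1 hν₀⟩, fun ν hν => ?_⟩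
  rw [hν.eq hlam0 hlam1 hν₀]
  have := hsymm.prob
  refine ⟨RectFree.isRectCumulants_iff hR hm, h0, fun hlam => ?_⟩
  rw [hpos hlam]
  exact ⟨rfl, RectFree.support_rectGaussian hlam hlam1,
    (RectFree.map_sq_rectGaussian hlam).trans
      (RectFree.map_mul_marchenkoPastur hlam hlam1).symm⟩
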